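/- Let $\beta\in(1,2)$, $T_\beta(x)=\beta x \bmod 1$ on $[0,1)$, and for $a,b\in\mathbb R$ let $J(a,b)=\{x\in(0,1): T_\beta^n(x)\notin(a,b)\ \forall n\ge 0\}$. An integer $n\ge1$ is \emph{bad} for $(a,b)$ if the orbit of every periodic point of $T_\beta$ of least period $n$ meets $(a,b)$. Let $\mathbf 1=d_1d_2\dots$ be the quasi-greedy $\beta$-expansion of $1$ and let $X_\beta$ (the admissible sequences) be the set of $x\in\{0,1\}^{\mathbb N}$ all of whose shifts are lexicographically $\preceq\mathbf 1$; an infinite word $x_1x_2\dots$ is identified with the number $\sum_i x_i\beta^{-i}$. Let $\gamma(\beta)\in(0,1)$ be the largest slope $\gamma$ whose set $X_\gamma$ of balanced (mechanical) sequences is contained in $X_\beta$, let $m=\inf X_{\gamma(\beta)}$, and let $I_\beta=(0m,\,1/\beta)\times(m,\,1m)$, where $0m=m/\beta$, $1m=(1+m)/\beta$. A pair $(s,t)$ of finite $0$-$1$ words is \emph{extremal} if $t$ is a cyclic permutation of $s$, $s^\infty\prec t^\infty$, and for every $k$ either $\sigma^ks^\infty\preceq s^\infty$ or $\sigma^ks^\infty\succeq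 t^\infty$ ($\sigma$ is the shift). An extremal pair with $s^\infty\in X_\beta$ is \emph{maximal} (for $\beta$) if no point of $(0,1)$ has its $T_\beta$-orbit contained in $[0,s^\infty)$ or contained in $(t^\infty,1)$, and there is no extremal pair $(\tilde s,\tilde t)$ with $\tilde s^\infty\in X_\beta$ and $(s^\infty,t^\infty)\subsetneq(\tilde s^\infty,\tilde t^\infty)$. For rational $r\in(0,1)$ let $w_r$ be the corresponding word of the Farey tree (roots $0,1$; the child of neighbours $w_1,w_2$ with $w_1^\infty<w_2^\infty$ is $w_2w_1$), and let $\rho_r$ be the substitution sending $0$ to the largest cyclic permutation of $w_r$ beginning with $0$, and $1$ to the smallest one beginning with $1$. The \emph{Farey descendants} of a maximal extremal pair $(S,R)$ are the pairs obtained from $(\rho_{r_1}\cdots\rho_{r_n}(0),\rho_{r_1}\cdots\rho_{r_n}(1))$, $n\ge0$, $r_i\in\mathbb Q\cap(0,1)$, by replacing each letter $0$ by $S$ and each letter $1$ by $R$. For $A\subseteq(0,1)$ write $A\doteq X$ if for every $y\in A$ there are $x\in X$ and a finite word $w$ such that the greedy expansion of $y$ is $w$ followed by the greedy expansion of $x$.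 \textbf{Theorem.} Let $(s,t)$ be an extremal pair such that every infinite concatenation of the words $s,t$ is in $X_\beta$ and $(s^\infty,t^\infty)\in I_\beta$. Let $u,v$ be words with $s=uv$, $t=vu$. \begin{enumerate} \item $J(s^\infty,t^\infty)\supseteq\{\sigma^ns^\infty:n\ge0\}$. \item If $s$ is primitive (not a proper power of a word), then for every $\epsilon>0$ the sets $J(s^\infty,ts^\infty-\epsilon)$ and $J(st^\infty+\epsilon,t^\infty)$ are uncountable. \item If $s$ is primitive and $|u|$, $|s|$ are coprime, then for every $\epsilon>0$ each of $(s^\infty,ts^\infty-\epsilon)$, $(st^\infty+\epsilon,t^\infty)$ and $(st^\infty+\epsilon,ts^\infty-\epsilon)$ has only finitely many bad $n$. \item If $(s,t)$ is maximal, then $J(s^\infty,t^\infty)\doteq\{\sigma^ns^\infty:n\ge0\}\cup\{0\}$; and if moreover $1/\beta\in(s^\infty,t^\infty)$, then $J(s^\infty,t^\infty)\doteq\{\sigma^ns^\infty:n\ge0\}$. \end{enumerate} If $(s,t)$ is a Farey descendant of a maximal extremal pair for $\beta$, then \begin{enumerate} \item[5.] $J(s^\infty,t^\infty)$ is countable;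 \item[6.] $J(sts^\infty,ts^\infty)$ and $J(st^\infty,tst^\infty)$ are countable. \end{enumerate} -/

import Mathlib

open Set Filter Topology

noncomputable section

namespace BetaHole

/-! Infinite words over the alphabet with letters `false` (the letter 0) and `true` (the letter 1);
the first letter of a sequence has index `0`. -/

/-- The shift iterated `k` times. -/
def shift (k : ℕ) (x : ℕ → Bool) : ℕ → Bool := fun i => x (i + k)

/-- Strict lexicographic order on infinite words. -/
def LexLT (x y : ℕ → Bool) : Prop :=
  ∃ k, (∀ i < k, x i = y i) ∧ x k = false ∧ y k = true

/-- Lexicographic order on infinite words. -/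
def LexLE (x y : ℕ → Bool) : Prop := LexLT x y ∨ x = y

/-- The infinite word `w w w ...` (used for nonempty `w`). -/
def per (w : List Bool) : ℕ → Bool := fun i => w.getD (i % w.length) false

/-- The concatenation of a finite word and an infinite word. -/
def cat (w : List Bool) (x : ℕ → Bool) : ℕ → Bool :=
  fun i => if i < w.length then w.getD i false else x (i - w.length)

/-- The set of all infinite concatenations of the blocks `s` and `t`, two words of equal length. -/
def blocks (s t : List Bool) : Set (ℕ → Bool) :=
  {x | ∃ c : ℕ → Bool, x = fun i =>
    (if c (i / s.length) then t else s).getD (i % s.length) false}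

/-- A word is primitive if it is nonempty and not a proper power of another word. -/
def IsPrimitive (w : List Bool) : Prop :=
  ∀ (x : List Bool) (k : ℕ), w = (List.replicate k x).flatten → k = 1

/-! The `β`-transformation and `β`-expansions. -/

/-- The `β`-transformation `x ↦ β x mod 1`. -/
def T (β : ℝ) (x : ℝ) : ℝ := Int.fract (β * x)

/-- The greedy expansion: the digit at index `i` is `⌊β T^i x⌋`, which is `0` or `1` when
`1 < β < 2` and `0 ≤ x ≤ 1`. -/
def greedy (β x : ℝ) : ℕ → Bool := fun i => decide (⌊β * (T β)^[i] x⌋ = 1)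

/-- The number `∑ x_i β^{-i}` (sum over `i ≥ 1`) represented by an infinite word. -/
def value (β : ℝ) (x : ℕ → Bool) : ℝ := ∑' i, (if x i then 1 else 0) * β⁻¹ ^ (i + 1)

open Classical in
/-- The quasi-greedy expansion of `1`: the greedy expansion of `1` if that has infinitely many
digits `1`; otherwise, if `k` is the index of its last digit `1`, the periodic word whose period
consists of the digits with index less than `k` followed by `0`. -/
def quasiGreedyOne (β : ℝ) : ℕ → Bool :=
  if h : ∃ k, greedy β 1 k = true ∧ ∀ j, k < j → greedy β 1 j = false then
    per ((List.range h.choose).map (greedy β 1) ++ [false])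
  else greedy β 1

/-- The admissible sequences for `β`. -/
def Admissible (β : ℝ) : Set (ℕ → Bool) :=
  {x | ∀ j, LexLE (shift j x) (quasiGreedyOne β)}

/-- The avoidance set of the hole `(a, b)`. -/
def J (β a b : ℝ) : Set ℝ := {x | x ∈ Ioo (0 : ℝ) 1 ∧ ∀ n, (T β)^[n] x ∉ Ioo a b}

/-- `n ≥ 1` is bad for `(a, b)` if the orbit of every periodic point of (least) period `n`
intersects `(a, b)`. -/
def IsBad (β a b : ℝ) (n : ℕ) : Prop :=
  0 < n ∧ ∀ x ∈ Ico (0 : ℝ) 1, Function.minimalPeriod (T β) x = n →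
    ∃ k, (T β)^[k] x ∈ Ioo a b

/-- Essential equality of an avoidance set `A` and an invariant set `X`: the expansion of every
point of `A` is a finite word followed by the expansion of a point of `X`. -/
def EssEq (β : ℝ) (A X : Set ℝ) : Prop :=
  ∀ y ∈ A, ∃ x ∈ X, ∃ w : List Bool, greedy β y = cat w (greedy β x)

/-! Balanced sequences and the region `I_β`. -/

/-- The set of balanced sequences of slope `γ`: all lower and upper mechanical words of slope `γ`.
For rational `γ = p / q` this is the orbit of the periodic balanced word with `p` ones in a period
of length `q`; for irrational `γ` it is the Sturmian subshift of slope `γ`. -/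
def balancedSet (γ : ℝ) : Set (ℕ → Bool) :=
  {x | ∃ ρ : ℝ,
    (x = fun i : ℕ => decide (⌊γ * (i + 1) + ρ⌋ - ⌊γ * i + ρ⌋ = 1)) ∨
    (x = fun i : ℕ => decide (⌈γ * (i + 1) + ρ⌉ - ⌈γ * i + ρ⌉ = 1))}

/-- `γ(β)`, the slope of the maximal admissible balanced word. -/
def gammaOf (β : ℝ) : ℝ := sSup {γ | γ ∈ Ioo (0 : ℝ) 1 ∧ balancedSet γ ⊆ Admissible β}

/-- The least point of the balanced set of slope `γ(β)`. -/
def infBalanced (β : ℝ) : ℝ := sInf (value β '' balancedSet (gammaOf β))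

/-- The region `I_β`; prefixing a digit `d` to a point `y` gives the point `(d + y) / β`. -/
def regionI (β : ℝ) : Set (ℝ × ℝ) :=
  Ioo (infBalanced β / β) (1 / β) ×ˢ Ioo (infBalanced β) ((1 + infBalanced β) / β)

/-! Extremal pairs. -/

/-- Extremal pairs of finite words. -/
def IsExtremal (s t : List Bool) : Prop :=
  List.IsRotated s t ∧ LexLT (per s) (per t) ∧
    ∀ k, LexLE (shift k (per s)) (per s) ∨ LexLE (per t) (shift k (per s))

/-- Maximal extremal pairs for `β`: admissible extremal pairs such that no orbit of a point of
`(0, 1)` lies on one side of the hole, and such that the hole is not properly contained in the hole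
of another admissible extremal pair. -/
def IsMaximal (β : ℝ) (s t : List Bool) : Prop :=
  IsExtremal s t ∧ per s ∈ Admissible β ∧
  (¬ ∃ x ∈ Ioo (0 : ℝ) 1,
    (∀ n, (T β)^[n] x ∈ Ico 0 (value β (per s))) ∨
    (∀ n, (T β)^[n] x ∈ Ioo (value β (per t)) 1)) ∧
  ¬ ∃ s' t' : List Bool, IsExtremal s' t' ∧ per s' ∈ Admissible β ∧
    Ioo (value β (per s)) (value β (per t)) ⊂ Ioo (value β (per s')) (value β (per t'))

/-! The Farey tree and Farey descendants. -/

/-- Pairs of neighbouring words (left, right) in the Farey tree; the child of `w₁, w₂` is `w₂ w₁`. -/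
inductive FareyNeighbours : List Bool → List Bool → Prop
  | root : FareyNeighbours [false] [true]
  | left {w₁ w₂ : List Bool} : FareyNeighbours w₁ w₂ → FareyNeighbours w₁ (w₂ ++ w₁)
  | right {w₁ w₂ : List Bool} : FareyNeighbours w₁ w₂ → FareyNeighbours (w₂ ++ w₁) w₂

/-- The words `w_γ` of the Farey tree, with `γ` rational in `(0, 1)`. -/
def IsFareyWord (w : List Bool) : Prop := ∃ w₁ w₂, FareyNeighbours w₁ w₂ ∧ w = w₂ ++ w₁

/-- `m` is the lexicographically largest cyclic permutation of `w` that begins with `u`. -/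
def IsPrefMax (u w m : List Bool) : Prop :=
  List.IsRotated w m ∧ u <+: m ∧ ∀ m', List.IsRotated w m' → u <+: m' → m' ≤ m

/-- `m` is the lexicographically smallest cyclic permutation of `w` that begins with `u`. -/
def IsPrefMin (u w m : List Bool) : Prop :=
  List.IsRotated w m ∧ u <+: m ∧ ∀ m', List.IsRotated w m' → u <+: m' → m ≤ m'

/-- The substitution `0 ↦ s`, `1 ↦ t` applied to a finite word. -/
def subst (s t : List Bool) (w : List Bool) : List Bool :=
  w.flatMap fun c => if c then t else s

/-- The pairs `(ρ_{r₁} ⋯ ρ_{rₙ}(0), ρ_{r₁} ⋯ ρ_{rₙ}(1))` with `n ≥ 0` and `rᵢ` rational in `(0, 1)`,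
where `ρ_r` is the substitution `0 ↦ 0-max(w_r)`, `1 ↦ 1-min(w_r)`. -/
inductive IsBalancedDescendant : List Bool → List Bool → Prop
  | nil : IsBalancedDescendant [false] [true]
  | cons {w a b s t : List Bool} : IsFareyWord w → IsPrefMax [false] w a → IsPrefMin [true] w b →
      IsBalancedDescendant s t → IsBalancedDescendant (subst a b s) (subst a b t)

/-- `(s, t)` is a Farey descendant of a maximal extremal pair `(S, R)` for `β`: a balanced
descendant pair written in the alphabet `S, R` in place of `0, 1`. -/
def IsFareyDescendantOfMaximal (β : ℝ) (s t : List Bool) : Prop :=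
  ∃ S R s₀ t₀ : List Bool, IsMaximal β S R ∧ IsBalancedDescendant s₀ t₀ ∧
    s = subst S R s₀ ∧ t = subst S R t₀

end BetaHole

end

/-!
Words are compared lexicographically, and Parry's criterion (`isGreedy_iff`) identifies the points
of `[0, 1)` with the words all of whose tails are less than the quasi-greedy expansion of one. Under
this identification `T β` becomes the shift, so every claim becomes one about words whose tails
avoid an interval. Since every concatenation of `s` and `t` is admissible, all tails of `s^∞` are
strictly below the quasi-greedy expansion, because `s^∞ < s t^∞`.

*Large avoidance sets.* For `s = u v`, `t = v u`, the words `u t^{n₁} u t^{n₂} …` with large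
exponents have all their tails just below tails `q t^∞` of the periodic word, and comparing `q s^∞`
with `t s^∞` (`IsExtremal.suffix_right`) shows that they avoid `(s^∞, t s^∞ - ε)`. The mirror images
`v s^{n₁} v s^{n₂} …` avoid `(s t^∞ + ε, t^∞)`, provided that they are admissible. The only
obstruction is that some `q t^∞`, with `q` a suffix of `s = p' 0 q`, is itself the quasi-greedy
expansion of one; then `s t^∞` and `p' 1 0^∞` have the same value and the words
`p' 1 0^{n₁} p' 1 0^{n₂} …` serve instead. In each case two words `h`, `k` that do not commute
generate uncountably many products, and all large numbers are least periods of such products when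
the lengths of `h` and `k` are coprime (`exists_uncountable_chain`, `exists_periodic_chain`).

*Maximal pairs.* The end points `s^∞` and `t^∞` are isolated among avoiding words
(`IsExtremal.isolated`). If an avoiding word ends neither in `0^∞` nor in `s^∞`, its tails visit
both sides of the hole infinitely often, and closing up its orbit between two close returns gives a
periodic avoiding word (`IsExtremal.exists_periodic`), whose points nearest to the hole form an
extremal pair with a larger hole, against maximality.

*Farey descendants.* An orbit avoiding a hole `(S x, R y)`, with `x`, `y` concatenations of `S` and
`R`, that enters `(S^∞, R^∞)` is trapped there and so is a concatenation of `S` and `R`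
(`eq_blk_of_trapped`). Its code avoids a hole in the full shift, and for the holes given by Farey
words only countably many codes do (`IsFareyWord.countable_dominated`), by renormalization along
the Farey tree. This gives the claims for descendants one substitution at a time, starting from the
maximal pair.
-/

namespace BetaHole

/-! ### Lexicographic order -/

variable {x y z : ℕ → Bool}

theorem lexLT_iff : LexLT x y ↔ toLex x < toLex y := by
  constructor
  · rintro ⟨k, h, h0, h1⟩
    exact ⟨k, h, by simp [h0, h1]⟩
  · rintro ⟨k, h, h'⟩
    have := Bool.lt_iff.1 h'
    exact ⟨k, h, this⟩

theorem lexLE_iff : LexLE x y ↔ toLex x ≤ toLex y := by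
  rw [LexLE, lexLT_iff, le_iff_lt_or_eq]; rfl

theorem LexLT.trans (h : LexLT x y) (h' : LexLT y z) : LexLT x z := by
  rw [lexLT_iff] at *; exact h.trans h'

theorem LexLT.trans_le (h : LexLT x y) (h' : LexLE y z) : LexLT x z := by
  rw [lexLT_iff, lexLE_iff] at *; exact h.trans_le h'

theorem LexLE.trans_lt (h : LexLE x y) (h' : LexLT y z) : LexLT x z := by
  rw [lexLT_iff, lexLE_iff] at *; exact h.trans_lt h'

theorem LexLE.trans (h : LexLE x y) (h' : LexLE y z) : LexLE x z := by
  rw [lexLE_iff] at *; exact h.trans h'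

theorem LexLT.le (h : LexLT x y) : LexLE x y := Or.inl h

theorem LexLE.refl (x : ℕ → Bool) : LexLE x x := Or.inr rfl

theorem LexLT.irrefl (x : ℕ → Bool) : ¬ LexLT x x := by
  rw [lexLT_iff]; exact lt_irrefl _

theorem not_lexLT : ¬ LexLT x y ↔ LexLE y x := by
  rw [lexLT_iff, lexLE_iff]; exact not_lt

theorem not_lexLE : ¬ LexLE x y ↔ LexLT y x := by
  rw [lexLT_iff, lexLE_iff]; exact not_le

theorem LexLE.lt_of_ne (h : LexLE x y) (h' : x ≠ y) : LexLT x y := h.resolve_right h'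

theorem LexLE.antisymm (h : LexLE x y) (h' : LexLE y x) : x = y := by
  rcases h with h | h
  · exact absurd h (not_lexLT.2 h')
  · exact h

/-- A strict inequality is decided within finitely many letters, so it passes to sequences that
agree with the left-hand side on these letters. -/
theorem LexLT.exists_bound (h : LexLT x y) :
    ∃ K, ∀ x' : ℕ → Bool, (∀ i < K, x' i = x i) → LexLT x' y := by
  obtain ⟨k, h, h0, h1⟩ := h
  exact ⟨k + 1, fun x' hx => ⟨k, fun i hi => (hx i (by omega)).trans (h i hi),
    (hx k (by omega)).trans h0, h1⟩⟩

/-! ### Shifts and concatenations -/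

@[simp] theorem shift_zero (x : ℕ → Bool) : shift 0 x = x := rfl

theorem shift_shift (a b : ℕ) (x : ℕ → Bool) : shift a (shift b x) = shift (a + b) x := by
  funext i; simp [shift, add_assoc]

theorem shift_apply (a i : ℕ) (x : ℕ → Bool) : shift a x i = x (i + a) := rfl

theorem cat_apply_lt {w : List Bool} {i : ℕ} (h : i < w.length) (x : ℕ → Bool) :
    cat w x i = w[i] := by simp [cat, h]

theorem cat_apply_add (w : List Bool) (i : ℕ) (x : ℕ → Bool) : cat w x (i + w.length) = x i := by
  simp [cat]

theorem cat_congr {w : List Bool} {i : ℕ} (h : i < w.length) (x y : ℕ → Bool) :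
    cat w x i = cat w y i := by simp [cat, h]

@[simp] theorem cat_nil (x : ℕ → Bool) : cat [] x = x := by
  funext i; simp [cat]

@[simp] theorem cat_cons_zero (a : Bool) (w : List Bool) (x : ℕ → Bool) : cat (a :: w) x 0 = a := by
  simp [cat]

@[simp] theorem shift_one_cat_cons (a : Bool) (w : List Bool) (x : ℕ → Bool) :
    shift 1 (cat (a :: w) x) = cat w x := by
  funext i; simp [cat, shift]

theorem cat_append (a b : List Bool) (x : ℕ → Bool) : cat (a ++ b) x = cat a (cat b x) := by
  funext i
  simp only [cat, List.length_append]
  rcases lt_or_ge i a.length with h | h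
  · simp [h, List.getD_eq_getElem?_getD, Nat.lt_add_right]
  · simp only [not_lt.2 h, if_false]
    simp only [List.getD_eq_getElem?_getD, List.getElem?_append_right h]
    congr 1
    · simp; omega
    · congr 1; omega

theorem shift_cat {w : List Bool} {j : ℕ} (h : j ≤ w.length) (x : ℕ → Bool) :
    shift j (cat w x) = cat (w.drop j) x := by
  conv_lhs => rw [← List.take_append_drop j w, cat_append]
  funext i
  have := cat_apply_add (w.take j) i (cat (w.drop j) x)
  rw [List.length_take, min_eq_left h] at this
  exact this

@[simp] theorem shift_length_cat (w : List Bool) (x : ℕ → Bool) : shift w.length (cat w x) = x := by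
  rw [shift_cat le_rfl]; simp

theorem shift_length_add_cat (w : List Bool) (j : ℕ) (x : ℕ → Bool) :
    shift (j + w.length) (cat w x) = shift j x := by
  rw [← shift_shift, shift_length_cat]

/-- The word formed by the first `n` letters of `x`. -/
def pre (n : ℕ) (x : ℕ → Bool) : List Bool := (List.range n).map x

@[simp] theorem length_pre (n : ℕ) (x : ℕ → Bool) : (pre n x).length = n := by simp [pre]

@[simp] theorem getElem_pre (n : ℕ) (x : ℕ → Bool) {i : ℕ} (h : i < (pre n x).length) :
    (pre n x)[i] = x i := by simp [pre]

@[simp] theorem cat_pre_shift (n : ℕ) (x : ℕ → Bool) : cat (pre n x) (shift n x) = x := by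
  funext i
  rcases lt_or_ge i n with h | h
  · rw [cat_apply_lt (by simpa using h)]; simp
  · have := cat_apply_add (pre n x) (i - n) (shift n x)
    rw [length_pre, Nat.sub_add_cancel h] at this
    rw [this, shift_apply, Nat.sub_add_cancel h]

theorem pre_cat (w : List Bool) (x : ℕ → Bool) : pre w.length (cat w x) = w := by
  apply List.ext_getElem
  · simp
  · intro i h1 h2
    rw [getElem_pre, cat_apply_lt h2]

theorem eq_cat_of_agree {w : List Bool} (h : ∀ i (h : i < w.length), x i = w[i]) :
    x = cat w (shift w.length x) := by
  have : pre w.length x = w := by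
    apply List.ext_getElem
    · simp
    · intro i h1 h2
      rw [getElem_pre, h i h2]
  conv_lhs => rw [← cat_pre_shift w.length x, this]

theorem cat_inj_right {w : List Bool} : cat w x = cat w y ↔ x = y := by
  refine ⟨fun h => ?_, fun h => by rw [h]⟩
  rw [← shift_length_cat w x, h, shift_length_cat]

theorem cat_inj_left {a b : List Bool} (hl : a.length = b.length) (h : cat a x = cat b y) :
    a = b ∧ x = y := by
  have h1 : a = b := by rw [← pre_cat a x, h, hl, pre_cat]
  subst h1
  exact ⟨rfl, cat_inj_right.1 h⟩

theorem lexLT_cat {w : List Bool} : LexLT (cat w x) (cat w y) ↔ LexLT x y := by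
  constructor
  · rintro ⟨k, h, h0, h1⟩
    rcases lt_or_ge k w.length with hk | hk
    · rw [cat_congr hk x y, h1] at h0; cases h0
    · obtain ⟨m, rfl⟩ := Nat.exists_eq_add_of_le' hk
      rw [cat_apply_add] at h0 h1
      refine ⟨m, fun i hi => ?_, h0, h1⟩
      have := h (i + w.length) (by omega)
      rwa [cat_apply_add, cat_apply_add] at this
  · rintro ⟨k, h, h0, h1⟩
    refine ⟨k + w.length, fun i hi => ?_, by rwa [cat_apply_add], by rwa [cat_apply_add]⟩
    rcases lt_or_ge i w.length with hk | hk
    · exact cat_congr hk x y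
    · obtain ⟨m, rfl⟩ := Nat.exists_eq_add_of_le' hk
      rw [cat_apply_add, cat_apply_add]; exact h m (by omega)

theorem lexLE_cat {w : List Bool} : LexLE (cat w x) (cat w y) ↔ LexLE x y := by
  rw [LexLE, LexLE, lexLT_cat, cat_inj_right]

/-- Strict lexicographic order on words, decided at a common position. -/
def WordLT (a b : List Bool) : Prop :=
  ∃ k, ∃ (ha : k < a.length) (hb : k < b.length),
    (∀ i (hi : i < k), a[i] = b[i]) ∧ a[k] = false ∧ b[k] = true

theorem WordLT.cat {a b : List Bool} (h : WordLT a b) (x y : ℕ → Bool) :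
    LexLT (cat a x) (cat b y) := by
  obtain ⟨k, ha, hb, h, h0, h1⟩ := h
  refine ⟨k, fun i hi => ?_, ?_, ?_⟩
  · rw [cat_apply_lt (by omega), cat_apply_lt (by omega), h i hi]
  · rw [cat_apply_lt ha, h0]
  · rw [cat_apply_lt hb, h1]

/-- Two infinite words beginning with words of equal length are compared by these words first. -/
theorem LexLT.wordLT_or {a b : List Bool} (hl : a.length = b.length)
    (h : LexLT (BetaHole.cat a x) (BetaHole.cat b y)) : WordLT a b ∨ (a = b ∧ LexLT x y) := by
  by_cases hab : a = b
  · subst hab; exact Or.inr ⟨rfl, lexLT_cat.1 h⟩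
  left
  obtain ⟨k, h, h0, h1⟩ := h
  have hk : k < a.length := by
    by_contra hk
    apply hab
    apply List.ext_getElem hl
    intro i hi hi'
    have := h i (by omega)
    rwa [cat_apply_lt hi, cat_apply_lt hi'] at this
  have hk' : k < b.length := by omega
  rw [cat_apply_lt hk] at h0
  rw [cat_apply_lt hk'] at h1
  refine ⟨k, hk, hk', fun i hi => ?_, h0, h1⟩
  have := h i hi
  rwa [cat_apply_lt (by omega), cat_apply_lt (by omega)] at this

/-! ### Periodic words -/

theorem per_apply {w : List Bool} (hw : w ≠ []) (i : ℕ) :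
    per w i = w[i % w.length]'(Nat.mod_lt _ (List.length_pos_iff.2 hw)) := by
  simp [per, Nat.mod_lt _ (List.length_pos_iff.2 hw)]

theorem per_eq_cat (w : List Bool) : per w = cat w (per w) := by
  rcases eq_or_ne w [] with rfl | hw
  · simp
  · funext i
    rcases lt_or_ge i w.length with h | h
    · rw [cat_apply_lt h, per_apply hw]; simp [Nat.mod_eq_of_lt h]
    · obtain ⟨m, rfl⟩ := Nat.exists_eq_add_of_le' h
      rw [cat_apply_add]; simp [per]

@[simp] theorem shift_length_per (w : List Bool) : shift w.length (per w) = per w := by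
  conv_lhs => rw [per_eq_cat, shift_length_cat]

theorem shift_mul_of_shift {d : ℕ} (h : shift d x = x) (m : ℕ) : shift (m * d) x = x := by
  induction m with
  | zero => simp
  | succ m ih => rw [add_mul, one_mul, ← shift_shift, h, ih]

theorem shift_mod_of_shift {d : ℕ} (h : shift d x = x) (j : ℕ) : shift j x = shift (j % d) x := by
  conv_lhs => rw [← Nat.mod_add_div' j d, ← shift_shift, shift_mul_of_shift h]

theorem apply_mod_of_shift {d : ℕ} (h : shift d x = x) (j : ℕ) : x j = x (j % d) := by
  have := congrFun (shift_mod_of_shift h j) 0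
  simpa [shift] using this

theorem shift_per_mod (w : List Bool) (j : ℕ) : shift j (per w) = shift (j % w.length) (per w) :=
  shift_mod_of_shift (shift_length_per w) j

/-- An infinite word is determined by its being fixed by prefixing a given nonempty word. -/
theorem eq_per_of_eq_cat {w : List Bool} (hw : w ≠ []) (h : x = cat w x) : x = per w := by
  have h' : shift w.length x = x := by conv_lhs => rw [h, shift_length_cat]
  funext i
  rw [apply_mod_of_shift h', per_apply hw]
  have hi := Nat.mod_lt i (List.length_pos_iff.2 hw)
  conv_lhs => rw [h, cat_apply_lt hi]

theorem eq_per_pre {n : ℕ} (hn : n ≠ 0) (h : shift n x = x) : x = per (pre n x) := by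
  apply eq_per_of_eq_cat
  · intro h0; apply hn; rw [← length_pre n x, h0]; rfl
  · conv_lhs => rw [← cat_pre_shift n x, h]

theorem cat_per_swap (u v : List Bool) : cat u (per (v ++ u)) = per (u ++ v) := by
  rcases eq_or_ne (u ++ v) [] with h | h
  · obtain ⟨rfl, rfl⟩ := List.append_eq_nil_iff.1 h; simp
  · apply eq_per_of_eq_cat h
    conv_lhs => rw [per_eq_cat]
    simp only [cat_append]

theorem shift_per_append (u v : List Bool) :
    shift u.length (per (u ++ v)) = per (v ++ u) := by
  rw [← cat_per_swap, shift_length_cat]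

theorem IsRotated.exists_append {s t : List Bool} (h : List.IsRotated s t) :
    ∃ u v, s = u ++ v ∧ t = v ++ u := by
  obtain ⟨n, rfl⟩ := h
  refine ⟨s.take (n % s.length), s.drop (n % s.length), by simp, ?_⟩
  rw [List.rotate_eq_drop_append_take_mod]

theorem isRotated_append (u v : List Bool) : List.IsRotated (u ++ v) (v ++ u) :=
  List.isRotated_append

theorem IsRotated.exists_shift {s t : List Bool} (h : List.IsRotated s t) :
    ∃ n, per t = shift n (per s) := by
  obtain ⟨u, v, rfl, rfl⟩ := IsRotated.exists_append h
  exact ⟨u.length, (shift_per_append u v).symm⟩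

theorem shift_per_isRotated (w : List Bool) (j : ℕ) :
    ∃ w', List.IsRotated w w' ∧ shift j (per w) = per w' := by
  rw [shift_per_mod]
  have h := shift_per_append (w.take (j % w.length)) (w.drop (j % w.length))
  rcases eq_or_ne w [] with rfl | hw
  · exact ⟨[], List.IsRotated.refl _, by funext i; simp [shift, per]⟩
  have hl : (w.take (j % w.length)).length = j % w.length := by
    simp [(Nat.mod_lt j (List.length_pos_iff.2 hw)).le]
  rw [List.take_append_drop, hl] at h
  refine ⟨_, ?_, h⟩
  conv_lhs => rw [← List.take_append_drop (j % w.length) w]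
  exact isRotated_append _ _

/-- Two words of the same length with `per s < per t` are compared as words. -/
theorem wordLT_of_per {s t : List Bool} (hl : s.length = t.length) (h : LexLT (per s) (per t)) :
    WordLT s t := by
  rw [per_eq_cat s, per_eq_cat t] at h
  rcases h.wordLT_or hl with h | ⟨rfl, h⟩
  · exact h
  · exact absurd h (LexLT.irrefl _)

/-- `rep k n` is the word `k` repeated `n` times. -/
def rep (k : List Bool) (n : ℕ) : List Bool := (List.replicate n k).flatten

@[simp] theorem rep_zero (k : List Bool) : rep k 0 = [] := rfl

theorem rep_succ (k : List Bool) (n : ℕ) : rep k (n + 1) = k ++ rep k n := by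
  simp [rep, List.replicate_succ]

theorem rep_succ' (k : List Bool) (n : ℕ) : rep k (n + 1) = rep k n ++ k := by
  simp [rep, List.replicate_succ']

@[simp] theorem length_rep (k : List Bool) (n : ℕ) : (rep k n).length = n * k.length := by
  simp [rep]

theorem cat_rep_per (k : List Bool) (n : ℕ) : cat (rep k n) (per k) = per k := by
  induction n with
  | zero => simp
  | succ n ih => rw [rep_succ, cat_append, ih, ← per_eq_cat]

/-- Conjugating powers: `u (v u)^n = (u v)^n u`. -/
theorem append_rep_swap (u v : List Bool) (n : ℕ) :
    u ++ rep (v ++ u) n = rep (u ++ v) n ++ u := by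
  induction n with
  | zero => simp
  | succ n ih => rw [rep_succ', rep_succ', ← List.append_assoc, ih]; simp

end BetaHole

namespace BetaHole

/-! ### The value of an infinite word -/

variable {β : ℝ} {x y : ℕ → Bool}

/-- A letter as a real number. -/
def dig (b : Bool) : ℝ := if b then 1 else 0

theorem dig_nonneg (b : Bool) : 0 ≤ dig b := by cases b <;> simp [dig]

theorem dig_le_one (b : Bool) : dig b ≤ 1 := by cases b <;> simp [dig]

theorem summable_value (hβ : 1 < β) (x : ℕ → Bool) :
    Summable fun i => dig (x i) * β⁻¹ ^ (i + 1) := by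
  have h0 : 0 < β⁻¹ := by positivity
  have h1 : β⁻¹ < 1 := inv_lt_one_of_one_lt₀ hβ
  refine Summable.of_nonneg_of_le (fun i => mul_nonneg (dig_nonneg _) (by positivity))
    (fun i => ?_) ((summable_geometric_of_lt_one h0.le h1).mul_left β⁻¹)
  rw [pow_succ']
  exact mul_le_of_le_one_left (by positivity) (dig_le_one _)

theorem value_def (β : ℝ) (x : ℕ → Bool) : value β x = ∑' i, dig (x i) * β⁻¹ ^ (i + 1) := rfl

theorem value_nonneg (hβ : 1 < β) (x : ℕ → Bool) : 0 ≤ value β x :=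
  tsum_nonneg fun i => mul_nonneg (dig_nonneg _) (by positivity)

theorem value_eq (hβ : 1 < β) (x : ℕ → Bool) :
    value β x = β⁻¹ * (dig (x 0) + value β (shift 1 x)) := by
  rw [value_def, (summable_value hβ x).tsum_eq_zero_add, value_def, mul_add, ← tsum_mul_left]
  congr 1
  · ring
  · congr 1; funext i; simp only [shift]; ring

theorem mul_value (hβ : 1 < β) (x : ℕ → Bool) :
    β * value β x = dig (x 0) + value β (shift 1 x) := by
  rw [value_eq hβ]; field_simp

theorem value_cons (hβ : 1 < β) (a : Bool) (x : ℕ → Bool) :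
    value β (cat [a] x) = β⁻¹ * (dig a + value β x) := by
  rw [value_eq hβ]; simp

theorem value_cat_sub (hβ : 1 < β) (w : List Bool) (x y : ℕ → Bool) :
    value β (cat w x) - value β (cat w y) = β⁻¹ ^ w.length * (value β x - value β y) := by
  induction w with
  | nil => simp
  | cons a w ih =>
    have (z : ℕ → Bool) : cat (a :: w) z = cat [a] (cat w z) := by rw [← cat_append]; rfl
    rw [this, this, value_cons hβ, value_cons hβ, List.length_cons, pow_succ', mul_assoc, ← ih]
    ring

theorem value_le (hβ : 1 < β) (x : ℕ → Bool) : value β x ≤ (β - 1)⁻¹ := by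
  have h0 : 0 < β⁻¹ := by positivity
  have h1 : β⁻¹ < 1 := inv_lt_one_of_one_lt₀ hβ
  have hb : β - 1 ≠ 0 := by linarith
  have : (β - 1)⁻¹ = ∑' i : ℕ, β⁻¹ * β⁻¹ ^ i := by
    rw [tsum_mul_left, tsum_geometric_of_lt_one h0.le h1]
    have : (1 - β⁻¹) = (β - 1) * β⁻¹ := by field_simp
    rw [this]; field_simp
  rw [this, value_def]
  refine (summable_value hβ x).tsum_le_tsum (fun i => ?_)
    ((summable_geometric_of_lt_one h0.le h1).mul_left β⁻¹)
  rw [pow_succ']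
  exact mul_le_of_le_one_left (by positivity) (dig_le_one _)

theorem value_pos (hβ : 1 < β) {i : ℕ} (h : x i = true) : 0 < value β x := by
  have h0 : 0 < β⁻¹ := by positivity
  refine (summable_value hβ x).tsum_pos (fun i => mul_nonneg (dig_nonneg _) (by positivity)) i ?_
  simp only [h, dig, if_true]; positivity

theorem value_zero (β : ℝ) : value β (fun _ => false) = 0 := by simp [value]

theorem pow_inv_tendsto (hβ : 1 < β) (C : ℝ) : Tendsto (fun n : ℕ => β⁻¹ ^ n * C) atTop (𝓝 0) := by
  have h0 : 0 < β⁻¹ := by positivity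
  simpa using (tendsto_pow_atTop_nhds_zero_of_lt_one h0.le
    (inv_lt_one_of_one_lt₀ hβ)).mul_const C

/-- For large `N`, changing a word after its first `N` letters raises its value by less than `ε`,
uniformly in the word. -/
theorem exists_value_close (hβ : 1 < β) {ε : ℝ} (hε : 0 < ε) :
    ∃ N : ℕ, ∀ (w : List Bool) (x y : ℕ → Bool), N ≤ w.length →
      value β (cat w x) < value β (cat w y) + ε := by
  obtain ⟨N, hN⟩ := ((pow_inv_tendsto hβ ((β - 1)⁻¹)).eventually_lt_const hε).exists_forall_of_atTop
  refine ⟨N, fun w x y hw => ?_⟩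
  have h1 := value_cat_sub hβ w x y
  have h2 := hN _ hw
  have h3 := value_le hβ x
  have h4 := value_nonneg hβ y
  have h5 : 0 ≤ β⁻¹ ^ w.length := by positivity
  nlinarith [mul_le_mul_of_nonneg_left (show value β x - value β y ≤ (β - 1)⁻¹ by linarith) h5]

/-- The difference of the values of two words, read off at the first letter where they differ. -/
theorem LexLT.value_sub (hβ : 1 < β) (h : LexLT x y) :
    ∃ k, value β y - value β x =
      β⁻¹ ^ (k + 1) * (1 + value β (shift (k + 1) y) - value β (shift (k + 1) x)) := by
  obtain ⟨k, h, h0, h1⟩ := h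
  refine ⟨k, ?_⟩
  have hx : x = cat (pre k x) (cat [false] (shift (k + 1) x)) := by
    conv_lhs => rw [← cat_pre_shift k x, eq_cat_of_agree (x := shift k x) (w := [false])
      (by simpa [shift] using h0), List.length_singleton, shift_shift, add_comm 1]
  have hy : y = cat (pre k x) (cat [true] (shift (k + 1) y)) := by
    have : pre k x = pre k y := List.ext_getElem (by simp) fun i h1 h2 => by
      simp only [getElem_pre]; exact h i (by simpa using h1)
    rw [this]
    conv_lhs => rw [← cat_pre_shift k y, eq_cat_of_agree (x := shift k y) (w := [true])
      (by simpa [shift] using h1), List.length_singleton, shift_shift, add_comm 1]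
  have := value_cat_sub hβ (pre k x) (cat [true] (shift (k + 1) y))
    (cat [false] (shift (k + 1) x))
  rw [← hx, ← hy, value_cons hβ, value_cons hβ, length_pre] at this
  rw [this, pow_succ]; simp only [dig, if_true, Bool.false_eq_true, if_false]; ring

theorem LexLT.value_le (hβ : 1 < β) (h : LexLT x y) (hx : ∀ j, value β (shift j x) ≤ 1) :
    value β x ≤ value β y := by
  obtain ⟨k, hk⟩ := h.value_sub hβ
  have := hx (k + 1)
  have h0 := value_nonneg hβ (shift (k + 1) y)
  have : 0 ≤ β⁻¹ ^ (k + 1) * (1 + value β (shift (k + 1) y) - value β (shift (k + 1) x)) :=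
    mul_nonneg (by positivity) (by linarith)
  linarith

theorem LexLE.value_le (hβ : 1 < β) (h : LexLE x y) (hx : ∀ j, value β (shift j x) ≤ 1) :
    value β x ≤ value β y := by
  rcases h with h | rfl
  · exact h.value_le hβ hx
  · exact le_rfl

/-- The value is strictly monotone at pairs whose larger word does not end in `0^∞`. -/
theorem LexLT.value_lt (hβ : 1 < β) (h : LexLT x y) (hx : ∀ j, value β (shift j x) ≤ 1)
    (hy : ∀ j, 0 < value β (shift j y)) : value β x < value β y := by
  obtain ⟨k, hk⟩ := h.value_sub hβ
  have := hx (k + 1)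
  have h0 := hy (k + 1)
  have : 0 < β⁻¹ ^ (k + 1) * (1 + value β (shift (k + 1) y) - value β (shift (k + 1) x)) :=
    mul_pos (by positivity) (by linarith)
  linarith

/-- The value is strictly monotone at pairs whose smaller word is a greedy expansion. -/
theorem LexLT.value_lt' (hβ : 1 < β) (h : LexLT x y) (hx : ∀ j, value β (shift j x) < 1) :
    value β x < value β y := by
  obtain ⟨k, hk⟩ := h.value_sub hβ
  have := hx (k + 1)
  have h0 := value_nonneg hβ (shift (k + 1) y)
  have : 0 < β⁻¹ ^ (k + 1) * (1 + value β (shift (k + 1) y) - value β (shift (k + 1) x)) :=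
    mul_pos (by positivity) (by linarith)
  linarith

/-! ### Greedy expansions and the quasi-greedy expansion of one -/

/-- The words all of whose tails have value less than one: these are the greedy expansions of the
points of `[0, 1)`. -/
def IsGreedy (β : ℝ) (x : ℕ → Bool) : Prop := ∀ j, value β (shift j x) < 1

theorem IsGreedy.shift (h : IsGreedy β x) (n : ℕ) : IsGreedy β (shift n x) := fun j => by
  rw [shift_shift]; exact h _

theorem IsGreedy.le (h : IsGreedy β x) (j : ℕ) : value β (BetaHole.shift j x) ≤ 1 := (h j).le

theorem IsGreedy.T_value (hβ : 1 < β) (h : IsGreedy β x) :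
    T β (value β x) = value β (BetaHole.shift 1 x) := by
  rw [T, mul_value hβ]
  have : Int.fract (value β (BetaHole.shift 1 x)) = value β (BetaHole.shift 1 x) :=
    Int.fract_eq_self.2 ⟨value_nonneg hβ _, h 1⟩
  cases x 0 <;> simp [dig, this]

theorem IsGreedy.iterate_T (hβ : 1 < β) (h : IsGreedy β x) (n : ℕ) :
    (T β)^[n] (value β x) = value β (BetaHole.shift n x) := by
  induction n with
  | zero => rfl
  | succ n ih =>
    rw [Function.iterate_succ_apply', ih, (h.shift n).T_value hβ, shift_shift, add_comm]

theorem IsGreedy.greedy_value (hβ : 1 < β) (h : IsGreedy β x) : greedy β (value β x) = x := by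
  funext i
  rw [greedy, h.iterate_T hβ, mul_value hβ, shift_shift, add_comm 1]
  have h1 := h (i + 1)
  have h0 := value_nonneg hβ (BetaHole.shift (i + 1) x)
  have hx : BetaHole.shift i x 0 = x i := by simp [BetaHole.shift]
  rw [hx]
  have hf : ⌊value β (BetaHole.shift (i + 1) x)⌋ = 0 := Int.floor_eq_zero_iff.2 ⟨h0, h1⟩
  cases x i
  · simp [dig, hf]
  · simp only [dig, if_true, decide_eq_true_eq]
    rw [add_comm, Int.floor_add_one, hf, zero_add]

theorem IsGreedy.value_inj (hβ : 1 < β) (h : IsGreedy β x) (h' : IsGreedy β y)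
    (he : value β x = value β y) : x = y := by
  rw [← h.greedy_value hβ, he, h'.greedy_value hβ]

theorem T_mem (z : ℝ) : T β z ∈ Ico (0 : ℝ) 1 := ⟨Int.fract_nonneg _, Int.fract_lt_one _⟩

theorem iterate_T_mem {z : ℝ} (hz : z ∈ Ico (0 : ℝ) 1) (n : ℕ) : (T β)^[n] z ∈ Ico (0 : ℝ) 1 := by
  cases n with
  | zero => exact hz
  | succ n => rw [Function.iterate_succ_apply']; exact T_mem _

theorem shift_greedy (n : ℕ) (z : ℝ) : shift n (greedy β z) = greedy β ((T β)^[n] z) := by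
  funext i; simp [shift, greedy, Function.iterate_add_apply]

theorem mul_eq_dig_add_T (hβ : β ∈ Ioo (1 : ℝ) 2) {z : ℝ} (hz : z ∈ Icc (0 : ℝ) 1) :
    β * z = dig (greedy β z 0) + T β z := by
  have h1 : 0 ≤ ⌊β * z⌋ := Int.floor_nonneg.2 (mul_nonneg (by linarith [hβ.1]) hz.1)
  have h2 : ⌊β * z⌋ < 2 := Int.floor_lt.2 (by push_cast; nlinarith [hβ.1, hβ.2, hz.1, hz.2])
  have h3 := Int.floor_add_fract (β * z)
  have h4 : greedy β z 0 = decide (⌊β * z⌋ = 1) := rfl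
  rw [h4, T, dig]
  have : ⌊β * z⌋ = 0 ∨ ⌊β * z⌋ = 1 := by omega
  rcases this with h | h
  · rw [h, Int.cast_zero] at h3; rw [if_neg (by simp [h])]; linarith
  · rw [h, Int.cast_one] at h3; rw [if_pos (by simp [h])]; linarith

theorem value_greedy (hβ : β ∈ Ioo (1 : ℝ) 2) {z : ℝ} (hz : z ∈ Icc (0 : ℝ) 1) :
    value β (greedy β z) = z := by
  set C := (β - 1)⁻¹ + 1
  have key : ∀ n : ℕ, ∀ z ∈ Icc (0 : ℝ) 1, |z - value β (greedy β z)| ≤ β⁻¹ ^ n * C := by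
    intro n
    induction n with
    | zero =>
      intro z hz
      have := value_le hβ.1 (greedy β z)
      have := value_nonneg hβ.1 (greedy β z)
      have : 0 < (β - 1)⁻¹ := by have := hβ.1; exact inv_pos.2 (by linarith)
      rw [abs_le]; constructor <;> simp only [C, pow_zero, one_mul] <;> linarith [hz.1, hz.2]
    | succ n ih =>
      intro z hz
      have h := ih (T β z) ⟨(T_mem z).1, (T_mem z).2.le⟩
      have h0 : 0 < β := by linarith [hβ.1]
      have : z - value β (greedy β z) = β⁻¹ * (T β z - value β (greedy β (T β z))) := by
        have h1 := mul_eq_dig_add_T hβ hz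
        have h2 := mul_value hβ.1 (greedy β z)
        rw [shift_greedy, Function.iterate_one] at h2
        field_simp; linarith
      rw [this, abs_mul, abs_of_pos (inv_pos.2 h0), pow_succ', mul_assoc]
      exact mul_le_mul_of_nonneg_left h (by positivity)
  have : |z - value β (greedy β z)| ≤ 0 :=
    ge_of_tendsto' (pow_inv_tendsto hβ.1 C) fun n => key n z hz
  linarith [abs_nonpos_iff.1 this]

theorem isGreedy_greedy (hβ : β ∈ Ioo (1 : ℝ) 2) {z : ℝ} (hz : z ∈ Ico (0 : ℝ) 1) :
    IsGreedy β (greedy β z) := fun j => by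
  have := iterate_T_mem (β := β) hz j
  rw [shift_greedy, value_greedy hβ ⟨this.1, this.2.le⟩]
  exact this.2

theorem value_shift_greedy_one (hβ : β ∈ Ioo (1 : ℝ) 2) (j : ℕ) :
    value β (shift j (greedy β 1)) ≤ 1 := by
  have : (T β)^[j] 1 ∈ Icc (0 : ℝ) 1 := by
    cases j with
    | zero => simp
    | succ j => rw [Function.iterate_succ_apply']; exact ⟨(T_mem _).1, (T_mem _).2.le⟩
  rw [shift_greedy, value_greedy hβ this]; exact this.2

theorem greedy_one_zero (hβ : β ∈ Ioo (1 : ℝ) 2) : greedy β 1 0 = true := by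
  have : ⌊β⌋ = 1 := Int.floor_eq_iff.2 ⟨by push_cast; exact hβ.1.le, by push_cast; linarith [hβ.2]⟩
  simp [greedy, this]

/-- Replacing a tail `1 0 0 0 …` by `0 y`, where `y` has value one, does not change the value. -/
theorem value_cat_true_zero (hβ : 1 < β) (w : List Bool) (hy : value β y = 1) :
    value β (cat w (cat [true] fun _ => false)) = value β (cat w (cat [false] y)) := by
  have := value_cat_sub hβ w (cat [true] fun _ => false) (cat [false] y)
  rw [value_cons hβ, value_cons hβ, value_zero, hy] at this
  simp only [dig, if_true, Bool.false_eq_true, if_false] at this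
  linarith [this, show β⁻¹ ^ w.length * (β⁻¹ * (1 + 0) - β⁻¹ * (0 + 1)) = 0 by ring]

/-- The quasi-greedy expansion of one represents one, its tails have values in `(0, 1]`, and its
first letter is `1`. -/
theorem quasiGreedyOne_spec (hβ : β ∈ Ioo (1 : ℝ) 2) :
    value β (quasiGreedyOne β) = 1 ∧ (∀ j, value β (shift j (quasiGreedyOne β)) ≤ 1) ∧
      (∀ j, 0 < value β (shift j (quasiGreedyOne β))) ∧ quasiGreedyOne β 0 = true := by
  have hb := hβ.1
  have hg0 := greedy_one_zero hβ
  have hv1 : value β (greedy β 1) = 1 := value_greedy hβ (by simp)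
  unfold quasiGreedyOne
  split_ifs with h
  · obtain ⟨hk1, hk2⟩ := h.choose_spec
    generalize h.choose = k at hk1 hk2
    change value β (per (pre k (greedy β 1) ++ [false])) = 1 ∧
      (∀ j, value β (shift j (per (pre k (greedy β 1) ++ [false]))) ≤ 1) ∧
      (∀ j, 0 < value β (shift j (per (pre k (greedy β 1) ++ [false])))) ∧
      per (pre k (greedy β 1) ++ [false]) 0 = true
    set p := pre k (greedy β 1)
    set X := per (p ++ [false])
    have hX : X = cat p (cat [false] X) := by rw [← cat_append]; exact per_eq_cat _
    have hG : greedy β 1 = cat p (cat [true] fun _ => false) := by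
      conv_lhs => rw [← cat_pre_shift k (greedy β 1), eq_cat_of_agree
        (x := shift k (greedy β 1)) (w := [true]) (by simpa [shift] using hk1)]
      congr 2
      funext i
      simp only [shift, List.length_singleton]
      exact hk2 _ (by omega)
    have hp : p.length = k := length_pre _ _
    have hk0 : k ≠ 0 := by
      rintro rfl
      have h1 : p = [] := List.length_eq_zero_iff.1 hp
      rw [h1, cat_nil] at hG
      rw [hG, value_cons hb, value_zero] at hv1
      simp only [dig, if_true] at hv1
      field_simp at hv1
      linarith
    have hx1 : value β X = 1 := by
      have h1 := value_cat_sub hb p (cat [true] fun _ => false) (cat [false] X)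
      rw [← hX, ← hG, hv1, value_cons hb, value_cons hb, value_zero] at h1
      simp only [dig, if_true, Bool.false_eq_true, if_false] at h1
      have h2 : (1 - value β X) * (1 - β⁻¹ ^ (p.length + 1)) = 0 := by
        rw [pow_succ]; linear_combination h1
      rcases mul_eq_zero.1 h2 with h3 | h3
      · linarith
      · have : β⁻¹ ^ (p.length + 1) < 1 :=
          pow_lt_one₀ (by positivity) (inv_lt_one_of_one_lt₀ hb) (by omega)
        linarith
    have hx0 : X 0 = true := by
      rw [← hg0]
      have h1 := cat_congr (w := p) (i := 0) (by omega) (cat [false] X) (cat [true] fun _ => false)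
      rwa [← hX, ← hG] at h1
    refine ⟨hx1, fun j => ?_, fun j => ?_, hx0⟩
    · rw [shift_per_mod]
      have hl : j % (p ++ [false]).length ≤ p.length := by
        have := Nat.mod_lt j (y := (p ++ [false]).length) (by simp)
        simp at this ⊢; omega
      generalize j % (p ++ [false]).length = i at hl
      change value β (shift i X) ≤ 1
      rw [hX, shift_cat hl, ← value_cat_true_zero hb _ hx1, ← shift_cat hl, ← hG]
      exact value_shift_greedy_one hβ i
    · refine value_pos hb (i := (p ++ [false]).length * (j + 1) - j) ?_
      have h2 : j ≤ (p ++ [false]).length * (j + 1) := by simp; nlinarith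
      rw [shift_apply, Nat.sub_add_cancel h2]
      have := shift_mul_of_shift (x := X) (shift_length_per _) (j + 1)
      rw [mul_comm, ← hx0]
      simpa [shift] using congrFun this 0
  · refine ⟨hv1, value_shift_greedy_one hβ, fun j => ?_, hg0⟩
    have : ∀ n, ∃ i, n ≤ i ∧ greedy β 1 i = true := by
      intro n
      induction n with
      | zero => exact ⟨0, le_rfl, hg0⟩
      | succ n ih =>
        obtain ⟨i, hi, hi'⟩ := ih
        by_contra hn
        push Not at hn
        have : i = n := by
          by_contra hne
          exact hn i (by omega) hi'
        subst this
        exact h ⟨i, hi', fun j hj => by simpa using hn j hj⟩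
    obtain ⟨i, hi, hi'⟩ := this j
    exact value_pos hb (i := i - j) (by rw [shift_apply, Nat.sub_add_cancel hi]; exact hi')

theorem Admissible.shift (h : x ∈ Admissible β) (n : ℕ) : shift n x ∈ Admissible β := fun j => by
  rw [shift_shift]; exact h _

/-- The excess of the value of an admissible word over one is at most `β⁻¹` times the excess of some
tail, so it is not positive. -/
theorem value_le_one_of_admissible (hβ : β ∈ Ioo (1 : ℝ) 2) (h : x ∈ Admissible β) :
    value β x ≤ 1 := by
  have hb := hβ.1
  obtain ⟨hq, -, hq0, -⟩ := quasiGreedyOne_spec hβ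
  set C := (β - 1)⁻¹
  have hC : 0 < C := inv_pos.2 (by linarith)
  have key : ∀ n : ℕ, ∀ x ∈ Admissible β, value β x - 1 ≤ β⁻¹ ^ n * C := by
    intro n
    induction n with
    | zero => intro x _; have := value_le hb x; simp; linarith
    | succ n ih =>
      intro x hx
      rcases hx 0 with h | h
      · obtain ⟨k, hk⟩ := h.value_sub hb
        have h1 := ih _ (Admissible.shift hx (k + 1))
        have h2 := hq0 (k + 1)
        rw [hq, shift_zero] at hk
        have h3 : value β x - 1 ≤ β⁻¹ ^ (k + 1) * (β⁻¹ ^ n * C) := by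
          have : 0 ≤ β⁻¹ ^ (k + 1) := by positivity
          nlinarith [mul_le_mul_of_nonneg_left h1 this, mul_nonneg this h2.le]
        refine h3.trans ?_
        rw [pow_succ' _ n, mul_assoc]
        refine mul_le_mul_of_nonneg_right ?_ (by positivity)
        exact pow_le_of_le_one (by positivity) (inv_le_one_of_one_le₀ hb.le) (by omega)
      · rw [shift_zero] at h
        rw [h, hq]; simp; positivity
  have : value β x - 1 ≤ 0 := ge_of_tendsto' (pow_inv_tendsto hb C) fun n => key n x h
  linarith

theorem Admissible.value_le_one (hβ : β ∈ Ioo (1 : ℝ) 2) (h : x ∈ Admissible β) (j : ℕ) :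
    value β (BetaHole.shift j x) ≤ 1 := value_le_one_of_admissible hβ (Admissible.shift h j)

theorem value_lt_one_of_lexLT (hβ : β ∈ Ioo (1 : ℝ) 2) (h : x ∈ Admissible β)
    (h' : LexLT x (quasiGreedyOne β)) : value β x < 1 := by
  obtain ⟨hq, -, hq0, -⟩ := quasiGreedyOne_spec hβ
  rw [← hq]
  exact h'.value_lt hβ.1 (Admissible.value_le_one hβ h) hq0

/-- Parry's criterion: a word is the greedy expansion of a point of `[0, 1)` exactly when all its
tails are lexicographically less than the quasi-greedy expansion of one. -/
theorem isGreedy_iff (hβ : β ∈ Ioo (1 : ℝ) 2) :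
    IsGreedy β x ↔ ∀ j, LexLT (shift j x) (quasiGreedyOne β) := by
  constructor
  · intro h j
    by_contra hc
    have := (not_lexLT.1 hc).value_le hβ.1 (quasiGreedyOne_spec hβ).2.1
    rw [(quasiGreedyOne_spec hβ).1] at this
    linarith [h j]
  · intro h j
    have hx : x ∈ Admissible β := fun j => (h j).le
    exact value_lt_one_of_lexLT hβ (Admissible.shift hx j) (h j)

theorem IsGreedy.admissible (hβ : β ∈ Ioo (1 : ℝ) 2) (h : IsGreedy β x) : x ∈ Admissible β :=
  fun j => ((isGreedy_iff hβ).1 h j).le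

theorem lexLT_of_value_lt (hβ : β ∈ Ioo (1 : ℝ) 2) (hy : y ∈ Admissible β)
    (h : value β x < value β y) : LexLT x y := by
  by_contra hc
  exact absurd ((not_lexLT.1 hc).value_le hβ.1 (Admissible.value_le_one hβ hy)) (not_le.2 h)

end BetaHole

namespace BetaHole

/-! ### Block substitution of equal length on infinite words -/

section Blk
variable {s t : List Bool} {c d : ℕ → Bool}

/-- The infinite concatenation of the words `s` and `t` coded by `c`. -/
def blk (s t : List Bool) (c : ℕ → Bool) : ℕ → Bool := fun i =>
  (if c (i / s.length) then t else s).getD (i % s.length) false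

theorem blk_mem_blocks (s t : List Bool) (c : ℕ → Bool) : blk s t c ∈ blocks s t := ⟨c, rfl⟩

theorem blk_eq_cat (hl : s.length = t.length) (hs : s ≠ []) (c : ℕ → Bool) :
    blk s t c = cat (if c 0 then t else s) (blk s t (shift 1 c)) := by
  have hp : 0 < s.length := List.length_pos_iff.2 hs
  have hl' : (if c 0 then t else s).length = s.length := by split_ifs <;> simp [hl]
  funext i
  rcases lt_or_ge i s.length with h | h
  · simp [blk, cat, hl', h, Nat.div_eq_of_lt h, Nat.mod_eq_of_lt h]
  · obtain ⟨m, rfl⟩ := Nat.exists_eq_add_of_le' h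
    have := cat_apply_add (if c 0 then t else s) m (blk s t (shift 1 c))
    rw [hl'] at this
    rw [this]
    simp only [blk]
    rw [Nat.add_div_right _ hp, Nat.add_mod_right]; rfl

theorem shift_blk (hl : s.length = t.length) (hs : s ≠ []) (c : ℕ → Bool) (n : ℕ) :
    shift (n * s.length) (blk s t c) = blk s t (shift n c) := by
  induction n generalizing c with
  | zero => simp
  | succ n ih =>
    have hl' : (if c 0 then t else s).length = s.length := by split_ifs <;> simp [hl]
    have := shift_length_cat (if c 0 then t else s) (blk s t (shift 1 c))
    rw [← blk_eq_cat hl hs, hl'] at this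
    rw [add_mul, one_mul, ← shift_shift, this, ih, shift_shift]

theorem lexLT_blk (hl : s.length = t.length) (hst : WordLT s t) (h : LexLT c d) :
    LexLT (blk s t c) (blk s t d) := by
  have hs : s ≠ [] := by
    rintro rfl; obtain ⟨k, ha, -⟩ := hst; simp at ha
  obtain ⟨k, h, h0, h1⟩ := h
  induction k generalizing c d with
  | zero =>
    rw [blk_eq_cat hl hs, blk_eq_cat hl hs d]
    simp only [h0, h1, if_true, Bool.false_eq_true, if_false]
    exact hst.cat _ _
  | succ k ih =>
    rw [blk_eq_cat hl hs, blk_eq_cat hl hs d, h 0 (by omega), lexLT_cat]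
    exact ih (fun i hi => h (i + 1) (by omega)) h0 h1

theorem blk_injective (hl : s.length = t.length) (hs : s ≠ []) (hst : s ≠ t) :
    Function.Injective (blk s t) := by
  intro c d h
  have key : ∀ (n : ℕ) (c d : ℕ → Bool), blk s t c = blk s t d → c n = d n := by
    intro n
    induction n with
    | zero =>
      intro c d h
      rw [blk_eq_cat hl hs, blk_eq_cat hl hs d] at h
      have h1 := (cat_inj_left (by split_ifs <;> simp [hl]) h).1
      cases hc : c 0 <;> cases hd : d 0 <;> simp [hc, hd] at h1 ⊢
      · exact hst h1
      · exact hst h1.symm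
    | succ n ih =>
      intro c d h
      rw [blk_eq_cat hl hs, blk_eq_cat hl hs d] at h
      exact ih _ _ (cat_inj_left (by split_ifs <;> simp [hl]) h).2
  exact funext fun n => key n c d h

end Blk

theorem not_countable_of_injective {α : Type*} {S : Set α} {f : (ℕ → Bool) → α}
    (hf : Function.Injective f) (h : ∀ c, f c ∈ S) : ¬ S.Countable := by
  intro hS
  have : Countable S := hS.to_subtype
  have hc : Countable (ℕ → Bool) :=
    Function.Injective.countable (f := fun c => (⟨f c, h c⟩ : S)) fun a b hab =>
      hf (congrArg Subtype.val hab)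
  obtain ⟨g, hg⟩ := exists_surjective_nat (ℕ → Bool)
  obtain ⟨n, hn⟩ := hg fun n => ! g n n
  have := congrFun hn n
  simp at this

/-! ### Chains of words `h kⁿ` -/

section Chain
variable {h k : List Bool} {N : ℕ} {E : Set (ℕ → Bool)} {x : ℕ → Bool}

/-- A set of infinite words each of which is `h kⁿ` followed by a word of the set, for some `n ≥ N`.
Thus its elements are the products `h k^{n₁} h k^{n₂} …` with all exponents at least `N`. -/
def IsChain (h k : List Bool) (N : ℕ) (E : Set (ℕ → Bool)) : Prop :=
  ∀ x ∈ E, ∃ n, N ≤ n ∧ ∃ y ∈ E, x = cat h (cat (rep k n) y)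

theorem drop_rep (k : List Bool) (n i : ℕ) (hi : i < n * k.length) :
    ∃ q m, q ≠ [] ∧ q <:+ k ∧ (rep k n).drop i = q ++ rep k m := by
  induction n generalizing i with
  | zero => simp at hi
  | succ n ih =>
    rw [rep_succ]
    rcases lt_or_ge i k.length with h | h
    · refine ⟨k.drop i, n, ?_, List.drop_suffix _ _, List.drop_append_of_le_length h.le⟩
      intro h0
      have := congrArg List.length h0
      simp at this; omega
    · obtain ⟨q, m, h1, h2, h3⟩ := ih (i - k.length) (by rw [add_mul] at hi; omega)
      refine ⟨q, m, h1, h2, ?_⟩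
      rw [List.drop_append, List.drop_of_length_le h, List.nil_append, h3]

/-- The tails of the elements of a chain. -/
theorem IsChain.shift (hE : IsChain h k N E) (hh : h ≠ []) (hx : x ∈ E) (j : ℕ) :
    (∃ n, N ≤ n ∧ ∃ y ∈ E, ∃ q, q ≠ [] ∧ q <:+ h ∧ shift j x = cat q (cat (rep k n) y)) ∨
    (∃ n, ∃ y ∈ E, ∃ q, q ≠ [] ∧ q <:+ k ∧ shift j x = cat q (cat (rep k n) y)) := by
  induction j using Nat.strong_induction_on generalizing x with
  | _ j ih =>
  obtain ⟨n, hn, y, hy, rfl⟩ := hE x hx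
  have hp : 0 < h.length := List.length_pos_iff.2 hh
  rcases lt_or_ge j h.length with hj | hj
  · left
    refine ⟨n, hn, y, hy, h.drop j, ?_, List.drop_suffix _ _, shift_cat hj.le _⟩
    intro h0
    have := congrArg List.length h0
    simp at this; omega
  · obtain ⟨i, rfl⟩ := Nat.exists_eq_add_of_le' hj
    rw [shift_length_add_cat]
    rcases lt_or_ge i (n * k.length) with hi | hi
    · right
      obtain ⟨q, m, h1, h2, h3⟩ := drop_rep k n i hi
      refine ⟨m, y, hy, q, h1, h2, ?_⟩
      rw [shift_cat (by simpa using hi.le), h3, cat_append]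
    · obtain ⟨l, rfl⟩ := Nat.exists_eq_add_of_le' hi
      have := shift_length_add_cat (rep k n) l y
      rw [length_rep] at this
      rw [this]
      exact ih l (by omega) hy

/-- Chains in two non-commuting words can be uncountable. -/
theorem exists_uncountable_chain (hhk : h ++ k ≠ k ++ h) (N : ℕ) :
    ∃ E, IsChain h k N E ∧ ¬ E.Countable := by
  set A := h ++ rep k N ++ (h ++ rep k (N + 1)) with hA
  set B := h ++ rep k (N + 1) ++ (h ++ rep k N) with hB
  have hh : h ≠ [] := by rintro rfl; simp at hhk
  have hl : A.length = B.length := by simp [hA, hB]; ring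
  have hA0 : A ≠ [] := by simp [hA, hh]
  have hAB : A ≠ B := by
    intro he
    have h1 : h ++ rep k N ++ (h ++ k ++ rep k N) = h ++ rep k N ++ (k ++ h ++ rep k N) := by
      rw [hA, hB] at he
      conv_lhs at he => rw [rep_succ]
      conv_rhs at he => rw [rep_succ']
      simpa using he
    exact hhk (List.append_cancel_right (List.append_cancel_left h1))
  refine ⟨{y | ∃ c, y = blk A B c ∨ y = cat h (cat (rep k (N + 1)) (blk A B c)) ∨
    y = cat h (cat (rep k N) (blk A B c))}, ?_, ?_⟩
  · rintro x ⟨c, rfl | rfl | rfl⟩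
    · rw [blk_eq_cat hl hA0]
      cases c 0
      · refine ⟨N, le_rfl, cat h (cat (rep k (N + 1)) (blk A B (BetaHole.shift 1 c))),
          ⟨_, Or.inr (Or.inl rfl)⟩, ?_⟩
        simp [hA, cat_append]
      · refine ⟨N + 1, by omega, cat h (cat (rep k N) (blk A B (BetaHole.shift 1 c))),
          ⟨_, Or.inr (Or.inr rfl)⟩, ?_⟩
        simp [hB, cat_append]
    · exact ⟨N + 1, by omega, _, ⟨c, Or.inl rfl⟩, rfl⟩
    · exact ⟨N, le_rfl, _, ⟨c, Or.inl rfl⟩, rfl⟩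
  · exact not_countable_of_injective (blk_injective hl hA0 hAB) fun c => ⟨c, Or.inl rfl⟩

theorem shift_eq_iterate (n : ℕ) (x : ℕ → Bool) : BetaHole.shift n x = (BetaHole.shift 1)^[n] x := by
  induction n with
  | zero => rfl
  | succ n ih => rw [Function.iterate_succ_apply', ← ih, shift_shift, add_comm]

theorem shift_gcd {m n : ℕ} (h1 : BetaHole.shift m x = x) (h2 : BetaHole.shift n x = x) :
    BetaHole.shift (m.gcd n) x = x := by
  rw [shift_eq_iterate] at *
  exact Function.IsPeriodicPt.gcd h1 h2

/-- If an infinite word of period `g` has a prefix of the form `k^L` of length at least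
`g + |k|`, then it is `k^∞`. -/
theorem eq_per_of_window {g L : ℕ} {z : ℕ → Bool} (hk : k ≠ []) (hg0 : 0 < g)
    (hg : BetaHole.shift g (cat (rep k L) z) = cat (rep k L) z) (hL : g + k.length ≤ L * k.length) :
    cat (rep k L) z = per k := by
  apply eq_per_of_eq_cat hk
  obtain ⟨M, rfl⟩ : ∃ M, L = M + 1 := by
    cases L with
    | zero => simp at hL; omega
    | succ M => exact ⟨M, rfl⟩
  have h1 : BetaHole.shift k.length (cat (rep k (M + 1)) z) = cat (rep k M) z := by
    rw [rep_succ, cat_append, shift_length_cat]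
  have h2 : cat (rep k (M + 1)) z = cat (rep k M) (cat k z) := by rw [rep_succ', cat_append]
  have h3 : BetaHole.shift g (cat (rep k M) z) = cat (rep k M) z := by
    rw [← h1, shift_shift, add_comm, ← shift_shift, hg]
  have h4 : cat (rep k M) z = cat (rep k (M + 1)) z := by
    funext i
    rw [apply_mod_of_shift h3, apply_mod_of_shift hg, h2]
    refine cat_congr ?_ _ _
    have := Nat.mod_lt i hg0
    rw [length_rep]; rw [add_mul] at hL; omega
  conv_lhs => rw [rep_succ, cat_append, h4]

/-- For two non-commuting words of coprime lengths, every large `n` is the least period of some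
element of a chain. -/
theorem exists_periodic_chain (hhk : h ++ k ≠ k ++ h) (hcop : Nat.Coprime h.length k.length)
    (N : ℕ) (hN : 1 ≤ N) :
    ∃ n₀, ∀ n, n₀ ≤ n → ∃ E, IsChain h k N E ∧ ∃ x ∈ E, BetaHole.shift n x = x ∧
      ∀ d, 0 < d → d < n → BetaHole.shift d x ≠ x := by
  have hk : k ≠ [] := by rintro rfl; simp at hhk
  have hh : h ≠ [] := by rintro rfl; simp at hhk
  set η := h.length with hη
  set κ := k.length with hκ
  have hκ0 : 0 < κ := List.length_pos_iff.2 hk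
  have hη0 : 0 < η := List.length_pos_iff.2 hh
  set C := κ * η + κ * (N * κ) with hC
  refine ⟨2 * (C + κ + N * κ), fun n hn => ?_⟩
  have hC' : κ * 1 ≤ κ * η := Nat.mul_le_mul_left _ hη0
  have hηC : η ≤ κ * η := Nat.le_mul_of_pos_left _ hκ0
  obtain ⟨m, hm, hmod⟩ := Nat.exists_mul_mod_eq_of_coprime (n - η) hcop hκ0.ne'
  have hmη : η * m + η ≤ κ * η := by
    have := Nat.mul_le_mul_left η (Nat.succ_le_of_lt hm)
    rw [Nat.mul_succ] at this; rw [mul_comm κ]; exact this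
  have hmN : m * (N * κ) ≤ κ * (N * κ) := Nat.mul_le_mul_right _ hm.le
  obtain ⟨M, hM⟩ : κ ∣ (n - η) - η * m := (Nat.modEq_iff_dvd' (by omega)).1 hmod
  have hML : m * N ≤ M := by
    by_contra hc
    have h2 : κ * M ≤ κ * (m * N) := Nat.mul_le_mul_left _ (by omega)
    have h3 : κ * (m * N) = m * (N * κ) := by ring
    omega
  obtain ⟨L, rfl⟩ := Nat.exists_eq_add_of_le hML
  -- the word `(h k^N)^m h k^L` has length `n`, and `k^L` covers more than half of it
  set X := h ++ rep k N with hX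
  set Y := h ++ rep k L with hY
  set w := rep X m ++ Y with hw
  have hwl : w.length = n := by
    have e1 : w.length = m * (η + N * κ) + (η + L * κ) := by simp [hw, hX, hY, hη, hκ]
    have e2 : m * (η + N * κ) + (η + L * κ) = η * m + η + κ * (m * N + L) := by ring
    omega
  have hbig : n + 2 * κ ≤ 2 * (L * κ) ∧ N * κ ≤ L * κ := by
    have e1 : κ * (m * N + L) = m * (N * κ) + L * κ := by ring
    constructor <;> omega
  have hw0 : w ≠ [] := by simp [hw, hY, hh]
  have hNL : N ≤ L := le_of_mul_le_mul_right hbig.2 hκ0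
  refine ⟨{y | ∃ j, j ≤ m ∧ y = cat (rep X j) (cat Y (per w))}, ?_, per w,
    ⟨m, le_rfl, by rw [← cat_append]; exact per_eq_cat w⟩, ?_, ?_⟩
  · rintro x ⟨j, hj, rfl⟩
    cases j with
    | zero =>
      refine ⟨L, hNL, per w, ⟨m, le_rfl, by rw [← cat_append]; exact per_eq_cat w⟩, ?_⟩
      simp [hY, cat_append]
    | succ j =>
      refine ⟨N, le_rfl, _, ⟨j, by omega, rfl⟩, ?_⟩
      rw [rep_succ, hX, cat_append, cat_append]
  · rw [← hwl]; exact shift_length_per w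
  · intro d hd0 hdn hd
    have hn' : BetaHole.shift n (per w) = per w := by rw [← hwl]; exact shift_length_per w
    have hg := shift_gcd hd hn'
    set g := d.gcd n with hgdef
    have hg0 : 0 < g := Nat.gcd_pos_of_pos_left _ hd0
    have hgn : 2 * g ≤ n := by
      obtain ⟨e, he⟩ : g ∣ n := Nat.gcd_dvd_right _ _
      have hgd : g ≤ d := Nat.le_of_dvd hd0 (Nat.gcd_dvd_left _ _)
      have : 2 ≤ e := by
        by_contra hc
        have : e = 0 ∨ e = 1 := by omega
        rcases this with rfl | rfl <;> omega
      have := Nat.mul_le_mul_left g this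
      omega
    have hsplit : per w = cat (rep X m ++ h) (cat (rep k L) (per w)) := by
      have : ∀ z, cat w z = cat (rep X m ++ h) (cat (rep k L) z) := fun z => by
        rw [hw, hY, ← List.append_assoc, cat_append]
      exact (per_eq_cat w).trans (this _)
    have hy : BetaHole.shift (rep X m ++ h).length (per w) = cat (rep k L) (per w) := by
      conv_lhs => rw [hsplit, shift_length_cat]
    have hgy : BetaHole.shift g (cat (rep k L) (per w)) = cat (rep k L) (per w) := by
      rw [← hy, shift_shift, add_comm, ← shift_shift, hg]
    have hper := eq_per_of_window hk hg0 hgy (by rw [← hκ]; omega)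
    have hwk : per w = per k := by
      have h1 : cat (rep k L) (per w) = cat (rep k L) (per k) := by rw [hper, cat_rep_per]
      exact cat_inj_right.1 h1
    obtain ⟨z, hz⟩ : ∃ z, per w = cat h (cat k z) := by
      have hone : ∀ n, 1 ≤ n → ∃ r, rep k n = k ++ r := by
        intro n hn
        obtain ⟨n, rfl⟩ := Nat.exists_eq_add_of_le' hn
        exact ⟨_, rep_succ k n⟩
      cases hm0 : m with
      | zero =>
        obtain ⟨r, hr⟩ := hone L (by omega)
        refine ⟨cat r (per w), ?_⟩
        have : ∀ z, cat w z = cat h (cat k (cat r z)) := fun z => by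
          rw [hw, hm0, hY, hr]; simp [cat_append]
        exact (per_eq_cat w).trans (this _)
      | succ m' =>
        obtain ⟨r, hr⟩ := hone N hN
        refine ⟨cat r (cat (rep X m') (cat Y (per w))), ?_⟩
        have : ∀ z, cat w z = cat h (cat k (cat r (cat (rep X m') (cat Y z)))) := fun z => by
          have hXr : X = h ++ k ++ r := by rw [hX, hr, List.append_assoc]
          rw [hw, hm0, rep_succ, cat_append, cat_append]
          nth_rewrite 1 [hXr]
          simp [cat_append]
        exact (per_eq_cat w).trans (this _)
    apply hhk
    refine (cat_inj_left (x := z) (y := cat k z) (by simp [add_comm]) ?_).1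
    rw [cat_append, cat_append, ← hz, hwk]
    exact per_eq_cat k

end Chain

end BetaHole

namespace BetaHole

/-! ### Extremal pairs -/

variable {β : ℝ} {s t : List Bool} {x y : ℕ → Bool}

theorem IsExtremal.length_eq (h : IsExtremal s t) : s.length = t.length := h.1.perm.length_eq

theorem IsExtremal.ne_nil (h : IsExtremal s t) : s ≠ [] := by
  rintro rfl
  have := h.length_eq
  obtain rfl : t = [] := List.length_eq_zero_iff.1 this.symm
  exact LexLT.irrefl _ h.2.1

theorem IsExtremal.wordLT (h : IsExtremal s t) : WordLT s t := wordLT_of_per h.length_eq h.2.1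

theorem IsExtremal.shift_right (h : IsExtremal s t) (k : ℕ) :
    LexLE (shift k (per t)) (per s) ∨ LexLE (per t) (shift k (per t)) := by
  obtain ⟨n, hn⟩ := IsRotated.exists_shift h.1
  have := h.2.2 (k + n)
  rwa [← shift_shift, ← hn] at this

theorem IsExtremal.true_mem_right (h : IsExtremal s t) : true ∈ t := by
  obtain ⟨k, -, hb, -, -, h1⟩ := h.wordLT
  rw [← h1]; exact List.getElem_mem hb

theorem IsExtremal.true_mem_left (h : IsExtremal s t) : true ∈ s :=
  h.1.mem_iff.2 h.true_mem_right

theorem shift_per_suffix {q : List Bool} (h : q <:+ s) :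
    ∃ i, shift i (per s) = cat q (per s) := by
  obtain ⟨p, rfl⟩ := h
  exact ⟨p.length, by conv_lhs => rw [per_eq_cat, cat_append, shift_length_cat]⟩

theorem shift_cat_suffix {q : List Bool} (h : q <:+ s) (x : ℕ → Bool) :
    ∃ i, shift i (cat s x) = cat q x := by
  obtain ⟨p, rfl⟩ := h
  exact ⟨p.length, by rw [cat_append, shift_length_cat]⟩

theorem blk_cat_cons (hl : s.length = t.length) (hs : s ≠ []) (b : Bool) (c : ℕ → Bool) :
    blk s t (cat [b] c) = cat (if b then t else s) (blk s t c) := by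
  rw [blk_eq_cat hl hs]; simp

theorem blk_const (hl : s.length = t.length) (hs : s ≠ []) (b : Bool) :
    blk s t (fun _ => b) = per (if b then t else s) := by
  apply eq_per_of_eq_cat
  · have ht : t ≠ [] := by rintro rfl; simp at hl; exact hs hl
    split_ifs <;> assumption
  · conv_lhs => rw [blk_eq_cat hl hs]
    rfl

theorem blk_mem (hl : s.length = t.length) (hs : s ≠ []) (h : blocks s t ⊆ Admissible β) :
    per s ∈ Admissible β ∧ per t ∈ Admissible β ∧ cat s (per t) ∈ Admissible β ∧
      cat t (per s) ∈ Admissible β ∧ cat s (cat t (per s)) ∈ Admissible β ∧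
      cat t (cat s (per t)) ∈ Admissible β := by
  have h0 : blk s t (fun _ => false) = per s := blk_const hl hs false
  have h1 : blk s t (fun _ => true) = per t := blk_const hl hs true
  have hs' : ∀ c, cat s (blk s t c) = blk s t (cat [false] c) := fun c =>
    (blk_cat_cons hl hs false c).symm
  have ht' : ∀ c, cat t (blk s t c) = blk s t (cat [true] c) := fun c =>
    (blk_cat_cons hl hs true c).symm
  have hb : ∀ c, blk s t c ∈ Admissible β := fun c => h (blk_mem_blocks _ _ _)
  rw [← h0, ← h1]
  simp only [hs', ht']
  exact ⟨hb _, hb _, hb _, hb _, hb _, hb _⟩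

/-- If `S^∞` is less than some admissible word beginning with `S`, then it is a greedy expansion. -/
theorem isGreedy_per_of_lexLT (hβ : β ∈ Ioo (1 : ℝ) 2) {S : List Bool} (hS : S ≠ [])
    (hy : cat S y ∈ Admissible β) (h : LexLT (per S) (cat S y)) : IsGreedy β (per S) := by
  rw [isGreedy_iff hβ]
  intro j
  rw [shift_per_mod]
  have hj : j % S.length ≤ S.length := (Nat.mod_lt _ (List.length_pos_iff.2 hS)).le
  refine LexLT.trans_le ?_ (hy (j % S.length))
  rw [shift_cat hj]
  conv_lhs => rw [per_eq_cat, shift_cat hj]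
  rw [lexLT_cat]
  rwa [per_eq_cat, lexLT_cat] at h

theorem IsExtremal.isGreedy_left (hβ : β ∈ Ioo (1 : ℝ) 2) (h : IsExtremal s t)
    (hadm : blocks s t ⊆ Admissible β) : IsGreedy β (per s) := by
  refine isGreedy_per_of_lexLT hβ h.ne_nil (blk_mem h.length_eq h.ne_nil hadm).2.2.1 ?_
  conv_lhs => rw [per_eq_cat]
  exact lexLT_cat.2 h.2.1

theorem IsExtremal.isGreedy_right (h : IsExtremal s t)
    (hg : IsGreedy β (per s)) : IsGreedy β (per t) := by
  obtain ⟨n, hn⟩ := IsRotated.exists_shift h.1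
  rw [hn]; exact hg.shift n

theorem value_cat_pos (hβ : 1 < β) {w : List Bool} (h : true ∈ w) (x : ℕ → Bool) :
    0 < value β (cat w x) := by
  obtain ⟨i, hi, h1⟩ := List.mem_iff_getElem.1 h
  exact value_pos hβ (i := i) (by rw [cat_apply_lt hi, h1])

theorem value_shift_per_pos (hβ : 1 < β) {w : List Bool} (h : true ∈ w) (j : ℕ) :
    0 < value β (shift j (per w)) := by
  obtain ⟨w', hw, h'⟩ := shift_per_isRotated w j
  rw [h', per_eq_cat]
  exact value_cat_pos hβ (hw.mem_iff.1 h) _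

theorem IsExtremal.orbit_subset_J (hβ : β ∈ Ioo (1 : ℝ) 2) (h : IsExtremal s t)
    (hg : IsGreedy β (per s)) :
    {x | ∃ n : ℕ, x = value β (shift n (per s))} ⊆ J β (value β (per s)) (value β (per t)) := by
  rintro x ⟨n, rfl⟩
  refine ⟨⟨value_shift_per_pos hβ.1 h.true_mem_left n, hg n⟩, fun k => ?_⟩
  rw [(hg.shift n).iterate_T hβ.1, shift_shift]
  rintro ⟨h1, h2⟩
  rcases h.2.2 (k + n) with h3 | h3
  · exact absurd (h3.value_le hβ.1 (hg.shift _).le) (not_le.2 h1)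
  · exact absurd (h3.value_le hβ.1 (h.isGreedy_right hg).le) (not_le.2 h2)

/-! ### Primitive extremal pairs -/

theorem IsPrimitive.shift_ne (h : IsPrimitive s) {d : ℕ} (h0 : 0 < d) (h1 : d < s.length) :
    shift d (per s) ≠ per s := by
  intro hd
  have hg := shift_gcd hd (shift_length_per s)
  set g := d.gcd s.length
  have hg0 : 0 < g := Nat.gcd_pos_of_pos_left _ h0
  have hgd : g ≤ d := Nat.le_of_dvd h0 (Nat.gcd_dvd_left _ _)
  obtain ⟨e, he⟩ : g ∣ s.length := Nat.gcd_dvd_right _ _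
  have hp := eq_per_pre hg0.ne' hg
  have := h (pre g (per s)) e ?_
  · subst this; omega
  · refine (cat_inj_left (x := per s) (y := per s) ?_ ?_).1
    · change s.length = (rep _ e).length
      rw [length_rep, length_pre, he, mul_comm]
    · have e1 := cat_rep_per (pre g (per s)) e
      rw [← hp] at e1
      exact (per_eq_cat s).symm.trans e1.symm

theorem IsExtremal.shift_ne_right (h : IsExtremal s t) (hp : IsPrimitive s) {d : ℕ} (h0 : 0 < d)
    (h1 : d < t.length) : shift d (per t) ≠ per t := by
  intro hd
  obtain ⟨n, hn⟩ := IsRotated.exists_shift h.1.symm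
  apply hp.shift_ne h0 (by rw [h.length_eq]; exact h1)
  rw [hn, shift_shift, add_comm, ← shift_shift, hd]

/-- If a suffix `q` of `t` satisfies `q t^∞ ≥ t^∞`, then `q s^∞ ≥ t s^∞`. -/
theorem IsExtremal.suffix_right (h : IsExtremal s t) (hp : IsPrimitive s) {q : List Bool}
    (hq0 : q ≠ []) (hq : q <:+ t) (hle : LexLE (per t) (cat q (per t))) :
    LexLE (cat t (per s)) (cat q (per s)) := by
  rcases eq_or_ne q.length t.length with hlen | hlen
  · rw [hq.eq_of_length hlen]; exact LexLE.refl _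
  have hlt : q.length < t.length := lt_of_le_of_ne hq.length_le hlen
  have hq0' := List.length_pos_iff.2 hq0
  have ht : ∀ z, cat t z = cat (t.take q.length) (cat (t.drop q.length) z) := fun z => by
    rw [← cat_append, List.take_append_drop]
  rcases hle with hle | heq
  · rw [ht (per s)]
    have hle' : LexLT (cat (t.take q.length) (cat (t.drop q.length) (per t))) (cat q (per t)) := by
      rwa [← ht, ← per_eq_cat]
    rcases LexLT.wordLT_or (by simp [hlt.le]) hle' with hw | ⟨hw, hlt'⟩
    · exact (hw.cat _ _).le
    · have hs : shift q.length (per t) = cat (t.drop q.length) (per t) := by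
        conv_lhs => rw [per_eq_cat, shift_cat hlt.le]
      have h1 := h.shift_right q.length
      rw [hs] at h1
      have h2 := h1.resolve_right fun h' => LexLT.irrefl _ (hlt'.trans_le h')
      rw [hw]
      exact (lexLT_cat.2 ((lexLT_cat.2 h.2.1).trans_le h2)).le
  · exfalso
    apply h.shift_ne_right hp hq0' hlt
    conv_lhs => rw [heq, shift_length_cat]

/-- If a suffix `q` of `s` satisfies `q s^∞ ≤ s^∞`, then `q t^∞ ≤ s t^∞`. -/
theorem IsExtremal.suffix_left (h : IsExtremal s t) (hp : IsPrimitive s) {q : List Bool}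
    (hq0 : q ≠ []) (hq : q <:+ s) (hle : LexLE (cat q (per s)) (per s)) :
    LexLE (cat q (per t)) (cat s (per t)) := by
  rcases eq_or_ne q.length s.length with hlen | hlen
  · rw [hq.eq_of_length hlen]; exact LexLE.refl _
  have hlt : q.length < s.length := lt_of_le_of_ne hq.length_le hlen
  have hq0' := List.length_pos_iff.2 hq0
  have hs : ∀ z, cat s z = cat (s.take q.length) (cat (s.drop q.length) z) := fun z => by
    rw [← cat_append, List.take_append_drop]
  rcases hle with hle | heq
  · rw [hs (per t)]
    have hle' : LexLT (cat q (per s)) (cat (s.take q.length) (cat (s.drop q.length) (per s))) := by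
      rwa [← hs, ← per_eq_cat]
    rcases LexLT.wordLT_or (by simp [hlt.le]) hle' with hw | ⟨hw, hlt'⟩
    · exact (hw.cat _ _).le
    · have hsh : shift q.length (per s) = cat (s.drop q.length) (per s) := by
        conv_lhs => rw [per_eq_cat, shift_cat hlt.le]
      have h1 := h.2.2 q.length
      rw [hsh] at h1
      have h2 := h1.resolve_left fun h' => LexLT.irrefl _ (hlt'.trans_le h')
      rw [← hw]
      exact (lexLT_cat.2 (h2.trans_lt (lexLT_cat.2 h.2.1))).le
  · exfalso
    apply hp.shift_ne hq0' hlt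
    conv_lhs => rw [← heq, shift_length_cat]

/-! ### Large avoidance sets from chains -/

/-- All elements of chains in `h`, `k` with large exponents are greedy expansions of points of
`(0, 1)` whose orbits avoid `(a, b)`. -/
def ChainsAvoid (β a b : ℝ) (h k : List Bool) : Prop :=
  ∃ N, 1 ≤ N ∧ ∀ E, IsChain h k N E → ∀ x ∈ E, IsGreedy β x ∧ 0 < value β x ∧
    ∀ j, value β (shift j x) ≤ a ∨ b ≤ value β (shift j x)

theorem ChainsAvoid.not_countable (hβ : β ∈ Ioo (1 : ℝ) 2) {a b : ℝ} {h k : List Bool}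
    (H : ChainsAvoid β a b h k) (hhk : h ++ k ≠ k ++ h) : ¬ (J β a b).Countable := by
  obtain ⟨N, -, H⟩ := H
  obtain ⟨E, hE, hunc⟩ := exists_uncountable_chain hhk N
  intro hJ
  apply hunc
  have hinj : InjOn (value β) E := fun x hx y hy hxy =>
    (H E hE x hx).1.value_inj hβ.1 (H E hE y hy).1 hxy
  refine MapsTo.countable_of_injOn (fun x hx => ?_) hinj hJ
  obtain ⟨h1, h2, h3⟩ := H E hE x hx
  refine ⟨⟨h2, h1 0⟩, fun n => ?_⟩
  rw [h1.iterate_T hβ.1]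
  rintro ⟨h4, h5⟩
  rcases h3 n with h6 | h6 <;> linarith

theorem minimalPeriod_value (hβ : 1 < β) (hx : IsGreedy β x) {n : ℕ} (hn : 0 < n)
    (h : shift n x = x) (hmin : ∀ d, 0 < d → d < n → shift d x ≠ x) :
    Function.minimalPeriod (T β) (value β x) = n := by
  have h1 : Function.IsPeriodicPt (T β) n (value β x) := by
    rw [Function.IsPeriodicPt, Function.IsFixedPt, hx.iterate_T hβ, h]
  refine le_antisymm (h1.minimalPeriod_le hn) ?_
  by_contra hlt
  have h2 := Function.isPeriodicPt_minimalPeriod (T β) (value β x)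
  rw [Function.IsPeriodicPt, Function.IsFixedPt, hx.iterate_T hβ] at h2
  exact hmin _ (h1.minimalPeriod_pos hn) (not_le.1 hlt) ((hx.shift _).value_inj hβ hx h2)

theorem ChainsAvoid.finite_bad (hβ : β ∈ Ioo (1 : ℝ) 2) {a b : ℝ} {h k : List Bool}
    (H : ChainsAvoid β a b h k) (hhk : h ++ k ≠ k ++ h)
    (hcop : Nat.Coprime h.length k.length) : {n | IsBad β a b n}.Finite := by
  obtain ⟨N, hN, H⟩ := H
  obtain ⟨n₀, hn₀⟩ := exists_periodic_chain hhk hcop N hN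
  refine (finite_lt_nat n₀).subset fun n hn => ?_
  by_contra hlt
  obtain ⟨E, hE, x, hx, hper, hmin⟩ := hn₀ n (not_lt.1 hlt)
  obtain ⟨h1, h2, h3⟩ := H E hE x hx
  obtain ⟨hn0, hbad⟩ := hn
  obtain ⟨k, hk⟩ := hbad (value β x) ⟨h2.le, h1 0⟩ (minimalPeriod_value hβ.1 h1 hn0 hper hmin)
  rw [h1.iterate_T hβ.1] at hk
  rcases h3 k with h6 | h6 <;> linarith [hk.1, hk.2]

theorem exists_rep_eq_append (k : List Bool) {n : ℕ} (hn : 1 ≤ n) : ∃ r, rep k n = k ++ r := by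
  obtain ⟨n, rfl⟩ := Nat.exists_eq_add_of_le' hn
  exact ⟨_, rep_succ k n⟩

/-- The chains in `u`, `t = v u` avoid the hole `(s^∞, t s^∞ - ε)`, where `s = u v`: their tails
`q t^m y` lie just below the tails `q t^∞` of the periodic word. -/
theorem IsExtremal.chainsAvoid_left (hβ : β ∈ Ioo (1 : ℝ) 2) {u v : List Bool}
    (h : IsExtremal (u ++ v) (v ++ u)) (hp : IsPrimitive (u ++ v))
    (hadm : blocks (u ++ v) (v ++ u) ⊆ Admissible β) (hu : u ≠ []) {ε : ℝ} (hε : 0 < ε) :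
    ChainsAvoid β (value β (per (u ++ v))) (value β (cat (v ++ u) (per (u ++ v))) - ε)
      u (v ++ u) := by
  have hb := hβ.1
  have hgs := h.isGreedy_left hβ hadm
  have hgt := h.isGreedy_right hgs
  obtain ⟨-, -, -, hats, -, -⟩ := blk_mem h.length_eq h.ne_nil hadm
  obtain ⟨N₀, hN₀⟩ := exists_value_close hb hε
  set s := u ++ v with hs
  set t := v ++ u with ht
  have hspos : 1 ≤ s.length := List.length_pos_iff.2 h.ne_nil
  refine ⟨N₀ + 1, by omega, fun E hE x hx => ?_⟩
  have hEs : ∀ y ∈ E, ∃ m, N₀ + 1 ≤ m ∧ ∃ y' ∈ E, y = cat (rep s m) (cat u y') := by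
    intro y hy
    obtain ⟨n, hn, y', hy', rfl⟩ := hE y hy
    exact ⟨n, hn, y', hy', by rw [← cat_append, ← cat_append, append_rep_swap]⟩
  have hEt : ∀ y ∈ E, ∀ m, LexLT (cat (rep t m) y) (per t) := by
    intro y hy m
    obtain ⟨n, hn, y', -, rfl⟩ := hEs y hy
    obtain ⟨r, hr⟩ := exists_rep_eq_append s (show 1 ≤ n by omega)
    rw [← cat_rep_per t m, lexLT_cat, hr, cat_append, per_eq_cat t]
    exact h.wordLT.cat _ _
  have htail : ∀ j, ∃ m, ∃ y ∈ E, ∃ q, q ≠ [] ∧ q <:+ t ∧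
      shift j x = cat q (cat (rep t m) y) := by
    intro j
    rcases hE.shift hu hx j with ⟨n, -, y, hy, q, h1, h2, h3⟩ | ⟨n, y, hy, q, h1, h2, h3⟩
    · exact ⟨n, y, hy, q, h1, h2.trans (List.suffix_append _ _), h3⟩
    · exact ⟨n, y, hy, q, h1, h2, h3⟩
  have hgx : IsGreedy β x := by
    rw [isGreedy_iff hβ]
    intro j
    obtain ⟨m, y, hy, q, -, hq, hj⟩ := htail j
    obtain ⟨i, hi⟩ := shift_per_suffix hq
    rw [hj]
    refine (lexLT_cat.2 (hEt y hy m)).trans ?_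
    rw [← hi]
    exact (isGreedy_iff hβ).1 hgt i
  refine ⟨hgx, ?_, fun j => ?_⟩
  · obtain ⟨n, hn, y, -, rfl⟩ := hE x hx
    obtain ⟨r, hr⟩ := exists_rep_eq_append t (show 1 ≤ n by omega)
    rw [hr, ← cat_append]
    exact value_cat_pos hb (by simp [h.true_mem_right]) _
  · have hz := hgx.shift j
    obtain ⟨m, y, hy, q, hq0, hq, hj⟩ := htail j
    obtain ⟨i, hi⟩ := shift_per_suffix hq
    obtain ⟨l, hl⟩ := shift_cat_suffix hq (per s)
    have h1 := h.shift_right i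
    rw [hi] at h1
    rw [hj] at hz ⊢
    rcases h1 with h1 | h1
    · exact Or.inl (((lexLT_cat.2 (hEt y hy m)).trans_le h1).value_le hb hz.le)
    · right
      have h2 := (h.suffix_right hp hq0 hq h1).value_le hb (Admissible.value_le_one hβ hats)
      have h3 : value β (cat q (per s)) ≤ value β (cat q (cat (rep t m) y)) + ε := by
        cases m with
        | zero =>
          obtain ⟨n, hn, y', -, rfl⟩ := hEs y hy
          have hlen : N₀ ≤ (q ++ rep s n).length := by
            rw [List.length_append, length_rep]
            have := Nat.mul_le_mul_left n hspos
            omega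
          have := hN₀ (q ++ rep s n) (per s) (cat u y') hlen
          rw [cat_append, cat_append, cat_rep_per] at this
          simpa using this.le
        | succ m =>
          have h4 : LexLT (cat q (per s)) (cat q (cat (rep t (m + 1)) y)) := by
            rw [lexLT_cat, rep_succ, cat_append, per_eq_cat s]
            exact h.wordLT.cat _ _
          have h5 : cat q (per s) ∈ Admissible β := by rw [← hl]; exact Admissible.shift hats l
          linarith [h4.value_le hb (Admissible.value_le_one hβ h5)]
      linarith

theorem suffix_uniform {p : List Bool} {P : List Bool → ℕ → Prop}
    (h : ∀ r, r <:+ p → ∃ N, ∀ n, N ≤ n → P r n) : ∃ N, ∀ r, r <:+ p → ∀ n, N ≤ n → P r n := by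
  have : ∀ᶠ n in atTop, ∀ r ∈ p.tails.toFinset, P r n := by
    rw [Filter.eventually_all_finset]
    intro r hr
    rw [eventually_atTop]
    exact h r (by simpa using hr)
  obtain ⟨N, hN⟩ := eventually_atTop.1 this
  exact ⟨N, fun r hr n hn => hN n hn r (by simpa using hr)⟩

/-- If all the words `q t^∞`, with `q` a suffix of `s`, are less than the quasi-greedy expansion of
one, then the chains in `v`, `s = u v` avoid the hole `(s t^∞ + ε, t^∞)`, where `t = v u`. -/
theorem IsExtremal.chainsAvoid_right (hβ : β ∈ Ioo (1 : ℝ) 2) {u v : List Bool}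
    (h : IsExtremal (u ++ v) (v ++ u)) (hp : IsPrimitive (u ++ v))
    (hadm : blocks (u ++ v) (v ++ u) ⊆ Admissible β) (hv : v ≠ [])
    (hlt : ∀ q, q ≠ [] → q <:+ (u ++ v) → LexLT (cat q (per (v ++ u))) (quasiGreedyOne β))
    {ε : ℝ} (hε : 0 < ε) :
    ChainsAvoid β (value β (cat (u ++ v) (per (v ++ u))) + ε) (value β (per (v ++ u)))
      v (u ++ v) := by
  have hb := hβ.1
  have hgs := h.isGreedy_left hβ hadm
  have hgt := h.isGreedy_right hgs
  obtain ⟨-, -, hast, -, -, -⟩ := blk_mem h.length_eq h.ne_nil hadm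
  obtain ⟨N₀, hN₀⟩ := exists_value_close hb hε
  set s := u ++ v with hs
  set t := v ++ u with ht
  have hspos : 1 ≤ s.length := List.length_pos_iff.2 h.ne_nil
  have htpos : 1 ≤ t.length := by rw [← h.length_eq]; exact hspos
  obtain ⟨K, hK⟩ := suffix_uniform (p := s) (P := fun q n => q ≠ [] → ∀ x' : ℕ → Bool,
      (∀ i < n, x' i = cat q (per t) i) → LexLT x' (quasiGreedyOne β)) (by
    intro q hq
    by_cases hq0 : q = []
    · exact ⟨0, fun n _ h => absurd hq0 h⟩
    · obtain ⟨K, hK⟩ := (hlt q hq0 hq).exists_bound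
      exact ⟨K, fun n hn _ x' hx' => hK x' fun i hi => hx' i (by omega)⟩)
  refine ⟨N₀ + K + 1, by omega, fun E hE x hx => ?_⟩
  have hEt : ∀ y ∈ E, ∃ m, N₀ + K + 1 ≤ m ∧ ∃ y' ∈ E, y = cat (rep t m) (cat v y') := by
    intro y hy
    obtain ⟨n, hn, y', hy', rfl⟩ := hE y hy
    exact ⟨n, hn, y', hy', by rw [← cat_append, ← cat_append, append_rep_swap]⟩
  have hEs : ∀ y ∈ E, ∀ m, LexLT (per s) (cat (rep s m) y) := by
    intro y hy m
    obtain ⟨n, hn, y', -, rfl⟩ := hEt y hy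
    obtain ⟨r, hr⟩ := exists_rep_eq_append t (show 1 ≤ n by omega)
    conv_lhs => rw [← cat_rep_per s m]
    rw [lexLT_cat, hr, cat_append, per_eq_cat s]
    exact h.wordLT.cat _ _
  have htail : ∀ j, ∃ m, ∃ y ∈ E, ∃ q, q ≠ [] ∧ q <:+ s ∧
      shift j x = cat q (cat (rep s m) y) := by
    intro j
    rcases hE.shift hv hx j with ⟨n, -, y, hy, q, h1, h2, h3⟩ | ⟨n, y, hy, q, h1, h2, h3⟩
    · exact ⟨n, y, hy, q, h1, h2.trans (List.suffix_append _ _), h3⟩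
    · exact ⟨n, y, hy, q, h1, h2, h3⟩
  have hup : ∀ q m y, LexLT (cat q (cat (rep s (m + 1)) y)) (cat q (per t)) := by
    intro q m y
    rw [lexLT_cat, rep_succ, cat_append, per_eq_cat t]
    exact h.wordLT.cat _ _
  have hgx : IsGreedy β x := by
    rw [isGreedy_iff hβ]
    intro j
    obtain ⟨m, y, hy, q, hq0, hq, hj⟩ := htail j
    rw [hj]
    cases m with
    | succ m => exact (hup q m y).trans (hlt q hq0 hq)
    | zero =>
      obtain ⟨n, hn, y', -, rfl⟩ := hEt y hy
      refine hK q hq K le_rfl hq0 _ fun i hi => ?_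
      have hlen : i < (q ++ rep t n).length := by
        rw [List.length_append, length_rep]
        have := Nat.mul_le_mul_left n htpos
        omega
      have e1 := cat_congr hlen (cat v y') (per t)
      rw [cat_append, cat_append, cat_rep_per] at e1
      simpa using e1
  refine ⟨hgx, ?_, fun j => ?_⟩
  · obtain ⟨n, hn, y, -, rfl⟩ := hE x hx
    obtain ⟨r, hr⟩ := exists_rep_eq_append s (show 1 ≤ n by omega)
    rw [hr, ← cat_append]
    exact value_cat_pos hb (by simp [h.true_mem_left]) _
  · have hz := hgx.shift j
    obtain ⟨m, y, hy, q, hq0, hq, hj⟩ := htail j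
    obtain ⟨i, hi⟩ := shift_per_suffix hq
    obtain ⟨l, hl⟩ := shift_cat_suffix hq (per t)
    have h1 := h.2.2 i
    rw [hi] at h1
    rw [hj] at hz ⊢
    rcases h1 with h1 | h1
    · left
      have h5 : cat q (per t) ∈ Admissible β := by rw [← hl]; exact Admissible.shift hast l
      have h2 := (h.suffix_left hp hq0 hq h1).value_le hb (Admissible.value_le_one hβ h5)
      have h3 : value β (cat q (cat (rep s m) y)) ≤ value β (cat q (per t)) + ε := by
        cases m with
        | zero =>
          obtain ⟨n, hn, y', -, rfl⟩ := hEt y hy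
          have hlen : N₀ ≤ (q ++ rep t n).length := by
            rw [List.length_append, length_rep]
            have := Nat.mul_le_mul_left n htpos
            omega
          have := hN₀ (q ++ rep t n) (cat v y') (per t) hlen
          rw [cat_append, cat_append, cat_rep_per] at this
          simpa using this.le
        | succ m => linarith [(hup q m y).value_le hb hz.le]
      linarith
    · right
      exact (h1.trans_lt (lexLT_cat.2 (hEs y hy m))).value_le hb hgt.le

theorem value_cat_zero_le (hβ : 1 < β) (w : List Bool) (x : ℕ → Bool) :
    value β (cat w fun _ => false) ≤ value β (cat w x) := by
  have h1 := value_cat_sub hβ w x fun _ => false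
  rw [value_zero] at h1
  have : 0 ≤ β⁻¹ ^ w.length * (value β x - 0) :=
    mul_nonneg (by positivity) (by linarith [value_nonneg hβ x])
  linarith

theorem cat_rep_false (n : ℕ) : (cat (rep [false] n) fun _ => false) = fun _ => false := by
  have : per [false] = fun _ => false := by funext i; simp [per, Nat.mod_one]
  rw [← this, cat_rep_per]

theorem value_cat_rep_false_le (hβ : 1 < β) (n : ℕ) (x : ℕ → Bool) :
    value β (cat (rep [false] n) x) ≤ value β x := by
  induction n with
  | zero => simp
  | succ n ih =>
    rw [rep_succ, cat_append, value_cons hβ]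
    refine le_trans ?_ ih
    simp only [dig, Bool.false_eq_true, if_false, zero_add]
    exact mul_le_of_le_one_left (value_nonneg hβ _) (inv_le_one_of_one_le₀ hβ.le)

/-- If `s = p' 0 q` and `q t^∞` is the quasi-greedy expansion of one, then `s t^∞` has the same
value as `p' 1 0^∞`, and the chains in `p' 1`, `0` avoid the hole `(s t^∞ + ε, t^∞)`. -/
theorem IsExtremal.chainsAvoid_zero (hβ : β ∈ Ioo (1 : ℝ) 2) (h : IsExtremal s t)
    (hp : IsPrimitive s) (hadm : blocks s t ⊆ Admissible β) {p q : List Bool}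
    (hs : s = p ++ [false] ++ q) (hq : cat q (per t) = quasiGreedyOne β)
    {ε : ℝ} (hε : 0 < ε) :
    ChainsAvoid β (value β (cat s (per t)) + ε) (value β (per t)) (p ++ [true]) [false] := by
  have hb := hβ.1
  have hgs := h.isGreedy_left hβ hadm
  have hgt := h.isGreedy_right hgs
  obtain ⟨-, -, hast, -, -, -⟩ := blk_mem h.length_eq h.ne_nil hadm
  have hq1 : value β (quasiGreedyOne β) = 1 := (quasiGreedyOne_spec hβ).1
  have hsuf : ∀ r, r <:+ p → r ++ [false] ++ q <:+ s := by
    rintro r ⟨r', rfl⟩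
    exact ⟨r', by simp [hs]⟩
  have hcat : ∀ r, cat (r ++ [false] ++ q) (per t) = cat r (cat [false] (quasiGreedyOne β)) := by
    intro r; rw [cat_append, cat_append, hq]
  have hval : ∀ r, value β (cat (r ++ [true]) fun _ => false) =
      value β (cat (r ++ [false] ++ q) (per t)) := by
    intro r; rw [hcat, cat_append, value_cat_true_zero hb _ hq1]
  have hadm' : ∀ r, r <:+ p → cat (r ++ [false] ++ q) (per t) ∈ Admissible β := by
    intro r hr
    obtain ⟨i, hi⟩ := shift_cat_suffix (hsuf r hr) (per t)
    rw [← hi]; exact Admissible.shift hast i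
  have hone : ∀ r, r <:+ p → value β (cat (r ++ [true]) fun _ => false) < 1 := by
    intro r hr
    rw [hval]
    refine value_lt_one_of_lexLT hβ (hadm' r hr) ((hadm' r hr 0).lt_of_ne ?_)
    -- otherwise the quasi-greedy expansion of one is periodic, hence a tail of `t^∞`
    intro he
    rw [shift_zero, cat_append, hq] at he
    have hper : shift (r ++ [false]).length (quasiGreedyOne β) = quasiGreedyOne β := by
      conv_lhs => rw [← he, shift_length_cat]
    have h1 := shift_mul_of_shift hper q.length
    have hle : q.length ≤ q.length * (r ++ [false]).length :=
      Nat.le_mul_of_pos_right _ (by simp)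
    obtain ⟨i, hi⟩ := Nat.exists_eq_add_of_le' hle
    rw [hi] at h1
    conv_lhs at h1 => rw [← hq, shift_length_add_cat]
    have h2 := (isGreedy_iff hβ).1 hgt i
    rw [h1] at h2
    exact LexLT.irrefl _ h2
  obtain ⟨N, hN⟩ := suffix_uniform (p := p) (P := fun r n => ∀ y,
      value β (cat (r ++ [true]) (cat (rep [false] n) y)) < 1 ∧
      value β (cat (r ++ [true]) (cat (rep [false] n) y)) <
        value β (cat (r ++ [false] ++ q) (per t)) + ε) (by
    intro r hr
    obtain ⟨N₁, hN₁⟩ := exists_value_close hb (sub_pos.2 (hone r hr))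
    obtain ⟨N₂, hN₂⟩ := exists_value_close hb hε
    refine ⟨N₁ + N₂, fun n hn y => ?_⟩
    have e1 := hN₁ (r ++ [true] ++ rep [false] n) y (fun _ => false) (by simp; omega)
    have e2 := hN₂ (r ++ [true] ++ rep [false] n) y (fun _ => false) (by simp; omega)
    rw [cat_append, cat_append _ _ fun _ => false, cat_rep_false] at e1 e2
    rw [← hval]
    exact ⟨by linarith, e2⟩)
  refine ⟨N + 1, by omega, fun E hE x hx => ?_⟩
  have hEv : ∀ y ∈ E, value β y < 1 ∧ value β y < value β (cat s (per t)) + ε := by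
    intro y hy
    obtain ⟨n, hn, y', -, rfl⟩ := hE y hy
    have := hN p (List.suffix_refl p) n (by omega) y'
    rwa [← hs] at this
  have htail : ∀ j, (∃ n, N + 1 ≤ n ∧ ∃ y ∈ E, ∃ r, r <:+ p ∧
      shift j x = cat (r ++ [true]) (cat (rep [false] n) y)) ∨
      ∃ n, ∃ y ∈ E, shift j x = cat (rep [false] n) y := by
    intro j
    rcases hE.shift (by simp) hx j with ⟨n, hn, y, hy, q, h1, h2, h3⟩ | ⟨n, y, hy, q, h1, h2, h3⟩
    · left
      rcases List.suffix_concat_iff.1 h2 with h4 | ⟨r, rfl, hr⟩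
      · exact absurd h4 h1
      · exact ⟨n, hn, y, hy, r, hr, h3⟩
    · right
      have h4 : q = [false] := by
        rcases List.suffix_cons_iff.1 h2 with h5 | h5
        · exact h5
        · exact absurd (List.suffix_nil.1 h5) h1
      subst h4
      exact ⟨n + 1, y, hy, by rw [h3, rep_succ, cat_append]⟩
  refine ⟨fun j => ?_, ?_, fun j => ?_⟩
  · rcases htail j with ⟨n, hn, y, hy, r, hr, hj⟩ | ⟨n, y, hy, hj⟩
    · rw [hj]; exact (hN r hr n (by omega) y).1
    · rw [hj]; exact (value_cat_rep_false_le hb n y).trans_lt (hEv y hy).1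
  · obtain ⟨n, hn, y, -, rfl⟩ := hE x hx
    exact value_cat_pos hb (by simp) _
  · rcases htail j with ⟨n, hn, y, hy, r, hr, hj⟩ | ⟨n, y, hy, hj⟩
    · rw [hj]
      obtain ⟨i, hi⟩ := shift_per_suffix (hsuf r hr)
      have h1 := h.2.2 i
      rw [hi] at h1
      rcases h1 with h1 | h1
      · left
        have := (h.suffix_left hp (by simp) (hsuf r hr) h1).value_le hb
          (Admissible.value_le_one hβ (hadm' r hr))
        linarith [(hN r hr n (by omega) y).2]
      · right
        have h2 := (h1.trans_lt (lexLT_cat.2 h.2.1)).value_le hb hgt.le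
        rw [← hval] at h2
        exact h2.trans (value_cat_zero_le hb _ _)
    · rw [hj]
      left
      exact (value_cat_rep_false_le hb n y).trans (hEv y hy).2.le

/-- The hole `(s t^∞ + ε, t^∞)` is avoided by the chains in two non-commuting words, whose lengths
are coprime if `|v|` and `|s|` are, where `s = u v`, `t = v u`. The condition `s^∞ < 1/β` makes `s`
begin with `0`. -/
theorem IsExtremal.exists_chainsAvoid_right (hβ : β ∈ Ioo (1 : ℝ) 2) {u v : List Bool}
    (h : IsExtremal (u ++ v) (v ++ u)) (hp : IsPrimitive (u ++ v))
    (hadm : blocks (u ++ v) (v ++ u) ⊆ Admissible β) (hv : v ≠ [])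
    (hI : value β (per (u ++ v)) < 1 / β) {ε : ℝ} (hε : 0 < ε) :
    ∃ a k, a ++ k ≠ k ++ a ∧
      (Nat.Coprime v.length (u ++ v).length → Nat.Coprime a.length k.length) ∧
      ChainsAvoid β (value β (cat (u ++ v) (per (v ++ u))) + ε) (value β (per (v ++ u))) a k := by
  have hb := hβ.1
  by_cases hlt : ∀ q, q ≠ [] → q <:+ (u ++ v) → LexLT (cat q (per (v ++ u))) (quasiGreedyOne β)
  · refine ⟨v, u ++ v, ?_, id, h.chainsAvoid_right hβ hp hadm hv hlt hε⟩
    intro he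
    rw [← List.append_assoc] at he
    have := h.2.1
    rw [List.append_cancel_right he] at this
    exact LexLT.irrefl _ this
  · push Not at hlt
    obtain ⟨q, hq0, ⟨p, hs⟩, hq⟩ := hlt
    obtain ⟨-, -, hast, -, -, -⟩ := blk_mem h.length_eq h.ne_nil hadm
    have hadmq : cat q (per (v ++ u)) ∈ Admissible β := by
      obtain ⟨i, hi⟩ := shift_cat_suffix ⟨p, hs⟩ (per (v ++ u))
      rw [← hi]; exact Admissible.shift hast i
    have hqe : cat q (per (v ++ u)) = quasiGreedyOne β :=
      (hadmq 0).antisymm (not_lexLT.1 hq)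
    have hspec := quasiGreedyOne_spec hβ
    -- `s` begins with `0`, whereas the quasi-greedy expansion of one begins with `1`
    have hs0 : per (u ++ v) 0 = false := by
      by_contra hc
      have h1 := value_eq hb (per (u ++ v))
      rw [show per (u ++ v) 0 = true by simpa using hc] at h1
      have h2 := value_nonneg hb (shift 1 (per (u ++ v)))
      simp only [dig, if_true] at h1
      have h3 : β⁻¹ * 1 ≤ β⁻¹ * (1 + value β (shift 1 (per (u ++ v)))) :=
        mul_le_mul_of_nonneg_left (by linarith) (by positivity)
      rw [one_div] at hI
      linarith
    rcases List.eq_nil_or_concat p with rfl | ⟨p', b, rfl⟩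
    · exfalso
      have hpos : 0 < (u ++ v).length := List.length_pos_iff.2 h.ne_nil
      rw [per_eq_cat, cat_congr hpos _ (per (v ++ u))] at hs0
      rw [List.nil_append] at hs
      rw [← hs, hqe, hspec.2.2.2] at hs0
      cases hs0
    · rw [List.concat_eq_append] at hs
      -- otherwise `1 q t^∞` would be an admissible word of value `2 / β > 1`
      have hb0 : b = false := by
        by_contra hc
        obtain rfl : b = true := by simpa using hc
        obtain ⟨i, hi⟩ := shift_cat_suffix (s := u ++ v) (q := [true] ++ q)
          ⟨p', by rw [← hs]; simp⟩ (per (v ++ u))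
        have h1 := Admissible.value_le_one hβ hast i
        rw [hi, cat_append, hqe, value_cons hb, hspec.1] at h1
        simp only [dig, if_true] at h1
        have h2 : β⁻¹ * (1 + 1) = 2 / β := by ring
        rw [h2, div_le_one (by linarith)] at h1
        linarith [hβ.2]
      subst hb0
      refine ⟨p' ++ [true], [false], ?_, fun _ => by simp,
        h.chainsAvoid_zero hβ hp hadm (by rw [← hs]) hqe hε⟩
      intro he
      have := congrArg List.reverse he
      simp at this

end BetaHole

namespace BetaHole

/-! ### Maximal extremal pairs -/

variable {β : ℝ} {s t : List Bool} {x y z : ℕ → Bool}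

theorem LexLT.of_agree_left {N : ℕ} (h : LexLT x y) (hN : ∃ i < N, x i ≠ y i)
    (hz : ∀ i < N, z i = x i) : LexLT z y := by
  obtain ⟨k, h, h0, h1⟩ := h
  have hk : k < N := by
    obtain ⟨i, hi, hne⟩ := hN
    by_contra hc
    exact hne (h i (by omega))
  exact ⟨k, fun i hi => (hz i (by omega)).trans (h i hi), (hz k hk).trans h0, h1⟩

theorem LexLT.of_agree_right {N : ℕ} (h : LexLT x y) (hN : ∃ i < N, x i ≠ y i)
    (hz : ∀ i < N, z i = y i) : LexLT x z := by
  obtain ⟨k, h, h0, h1⟩ := h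
  have hk : k < N := by
    obtain ⟨i, hi, hne⟩ := hN
    by_contra hc
    exact hne (h i (by omega))
  exact ⟨k, fun i hi => (h i hi).trans (hz i (by omega)).symm, h0, (hz k hk).trans h1⟩

theorem LexLT.exists_ne (h : LexLT x y) : ∃ N, ∃ i < N, x i ≠ y i := by
  obtain ⟨k, -, h0, h1⟩ := h
  exact ⟨k + 1, k, by omega, by rw [h0, h1]; simp⟩

/-- The words `s^∞` and `t^∞` are isolated among the words whose orbits avoid the hole
`(s^∞, t^∞)` without meeting its end points: following `s^∞` from below for `|u| + |s|` letters
brings the orbit just below `t^∞`, hence into the hole. -/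
theorem IsExtremal.isolated (h : IsExtremal s t) :
    ∃ K, ∀ y : ℕ → Bool, (∀ n, LexLT (shift n y) (per s) ∨ LexLT (per t) (shift n y)) →
      ∀ n x', (∀ i < K, x' i = shift n y i) →
        (LexLT (shift n y) (per s) → LexLT x' (per s)) ∧
        (LexLT (per t) (shift n y) → LexLT (per t) x') := by
  obtain ⟨u, v, rfl, rfl⟩ := IsRotated.exists_append h.1
  set s := u ++ v with hs
  set t := v ++ u with ht
  obtain ⟨K, hK⟩ := h.2.1.exists_ne
  have h1 : cat u (per t) = per s := cat_per_swap u v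
  have h2 : cat v (per s) = per t := cat_per_swap v u
  refine ⟨K + s.length, fun y hy n x' hx' => ⟨fun hlt => ?_, fun hlt => ?_⟩⟩
  · refine hlt.of_agree_left (N := K + s.length) ?_ hx'
    by_contra hag
    push Not at hag
    have hu : u.length ≤ s.length := by simp [hs]
    have e1 : shift n y = cat u (shift (u.length + n) y) := by
      rw [← shift_shift]
      refine eq_cat_of_agree fun i hi => ?_
      rw [hag i (by omega), ← h1, cat_apply_lt hi]
    have e2 : LexLT (shift (u.length + n) y) (per t) := by
      rwa [e1, ← h1, lexLT_cat] at hlt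
    have e3 : LexLT (per s) (shift (u.length + n) y) := by
      refine h.2.1.of_agree_right hK fun i hi => ?_
      have := hag (i + u.length) (by omega)
      rw [e1, ← h1, cat_apply_add, cat_apply_add] at this
      exact this
    rcases hy (u.length + n) with h3 | h3
    · exact LexLT.irrefl _ (h3.trans e3)
    · exact LexLT.irrefl _ (h3.trans e2)
  · refine hlt.of_agree_right (N := K + s.length) ?_ hx'
    by_contra hag
    push Not at hag
    have hv : v.length ≤ s.length := by simp [hs]
    have e1 : shift n y = cat v (shift (v.length + n) y) := by
      rw [← shift_shift]
      refine eq_cat_of_agree fun i hi => ?_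
      rw [← hag i (by omega), ← h2, cat_apply_lt hi]
    have e2 : LexLT (per s) (shift (v.length + n) y) := by
      rwa [e1, ← h2, lexLT_cat] at hlt
    have e3 : LexLT (shift (v.length + n) y) (per t) := by
      refine h.2.1.of_agree_left hK fun i hi => ?_
      have := hag (i + v.length) (by omega)
      rw [e1, ← h2, cat_apply_add, cat_apply_add] at this
      exact this.symm
    rcases hy (v.length + n) with h3 | h3
    · exact LexLT.irrefl _ (h3.trans e2)
    · exact LexLT.irrefl _ (h3.trans e3)

/-- If `w z` and `z` agree on `N` letters, then `w^∞` and `w z` agree on `N + |w|` letters. -/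
theorem per_agree {w : List Bool} {N : ℕ} (hw : w ≠ [])
    (h : ∀ i < N, cat w z i = z i) : ∀ m < N + w.length, per w m = cat w z m := by
  intro m
  induction m using Nat.strong_induction_on with
  | _ m ih =>
  intro hm
  have hp := List.length_pos_iff.2 hw
  rcases lt_or_ge m w.length with hlt | hge
  · rw [per_eq_cat]; exact cat_congr hlt _ _
  · obtain ⟨l, rfl⟩ := Nat.exists_eq_add_of_le' hge
    rw [per_eq_cat, cat_apply_add, cat_apply_add, ih l (by omega) (by omega), h l (by omega)]

/-- If `w z < z`, then `w^∞ < z`. -/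
theorem per_lexLT_of_cat {w : List Bool} (hw : w ≠ []) (h : LexLT (cat w z) z) :
    LexLT (per w) z := by
  obtain ⟨k, h, h0, h1⟩ := h
  have hp := List.length_pos_iff.2 hw
  have := per_agree hw h
  exact ⟨k, fun i hi => (this i (by omega)).trans (h i hi), (this k (by omega)).trans h0, h1⟩

/-- If an orbit of greedy expansions avoids the closed hole `[s^∞, t^∞]` and visits both sides of it
infinitely often, then some periodic orbit of greedy expansions does so as well. The period is the
word between two close times of return; when the orbit accumulates at the quasi-greedy expansion of
one, the returns are chosen near that point and increasing, so that closing up the orbit decreases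
all its points. -/
theorem IsExtremal.exists_periodic (hβ : β ∈ Ioo (1 : ℝ) 2) (h : IsExtremal s t)
    (hg : IsGreedy β y) (hy : ∀ n, LexLT (shift n y) (per s) ∨ LexLT (per t) (shift n y))
    (hlow : ∀ n, ∃ m, n ≤ m ∧ LexLT (shift m y) (per s))
    (hup : ∀ n, ∃ m, n ≤ m ∧ LexLT (per t) (shift m y)) :
    ∃ w, w ≠ [] ∧ IsGreedy β (per w) ∧
      (∀ k, LexLT (shift k (per w)) (per s) ∨ LexLT (per t) (shift k (per w))) ∧
      (∃ k, LexLT (shift k (per w)) (per s)) ∧ ∃ k, LexLT (per t) (shift k (per w)) := by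
  obtain ⟨K, hK⟩ := h.isolated
  have hq := (isGreedy_iff hβ).1 hg
  set q := quasiGreedyOne β
  -- it suffices to find two times of return
  suffices hmain : ∃ i j k₁ k₂ N, i ≤ k₁ ∧ i ≤ k₂ ∧ k₁ < j ∧ k₂ < j ∧
      LexLT (shift k₁ y) (per s) ∧ LexLT (per t) (shift k₂ y) ∧ K ≤ N ∧
      (∀ l < N, shift i y l = shift j y l) ∧
      (LexLT (shift i y) (shift j y) ∨ ∀ n, ∃ l < N, shift n y l ≠ q l) by
    obtain ⟨i, j, k₁, k₂, N, hik₁, hik₂, hk₁j, hk₂j, hs₁, ht₂, hKN, hag, hcase⟩ := hmain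
    set w := pre (j - i) (shift i y) with hw
    have hwl : w.length = j - i := length_pre _ _
    have hw0 : w ≠ [] := by
      intro h0; rw [h0] at hwl; simp at hwl; omega
    have hcat : cat w (shift j y) = shift i y := by
      have := cat_pre_shift (j - i) (shift i y)
      rwa [shift_shift, Nat.sub_add_cancel (by omega)] at this
    have hagree := per_agree (z := shift j y) (N := N) hw0 (by rw [hcat]; exact hag)
    rw [hcat] at hagree
    have hagk : ∀ k ≤ w.length, ∀ l < N, shift k (per w) l = shift (i + k) y l := by
      intro k hk l hl
      have := hagree (l + k) (by omega)
      rw [shift_apply, this, shift_apply, shift_apply]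
      congr 1; omega
    have hmod : ∀ k, ∃ k', k' < w.length ∧ shift k (per w) = shift k' (per w) := fun k =>
      ⟨_, Nat.mod_lt _ (List.length_pos_iff.2 hw0), shift_per_mod w k⟩
    have hiso : ∀ k ≤ w.length, _ := fun k hk =>
      hK y hy (i + k) (shift k (per w)) fun l hl => hagk k hk l (by omega)
    refine ⟨w, hw0, (isGreedy_iff hβ).2 fun k => ?_, fun k => ?_, ⟨k₁ - i, ?_⟩, ⟨k₂ - i, ?_⟩⟩
    · obtain ⟨k', hk', he⟩ := hmod k
      rw [he]
      rcases hcase with hlt | hne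
      · have h1 : LexLT (per w) (shift j y) := per_lexLT_of_cat hw0 (by rwa [hcat])
        have h2 : shift k' (per w) = cat (w.drop k') (per w) := by
          conv_lhs => rw [per_eq_cat, shift_cat hk'.le]
        rw [h2]
        refine (lexLT_cat.2 h1).trans ?_
        rw [← shift_cat hk'.le, hcat, shift_shift]
        exact hq _
      · exact (hq (i + k')).of_agree_left (hne _) (hagk k' hk'.le)
    · obtain ⟨k', hk', he⟩ := hmod k
      rw [he]
      exact (hy (i + k')).imp (hiso k' hk'.le).1 (hiso k' hk'.le).2
    · exact (hiso (k₁ - i) (by omega)).1 (by rwa [Nat.add_sub_cancel' hik₁])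
    · exact (hiso (k₂ - i) (by omega)).2 (by rwa [Nat.add_sub_cancel' hik₂])
  -- either the orbit keeps away from the quasi-greedy expansion of one, or it accumulates there
  by_cases hacc : ∃ N₀, ∀ n, ∃ l < N₀, shift n y l ≠ q l
  · obtain ⟨N₀, hN₀⟩ := hacc
    obtain ⟨f, hf⟩ := Finite.exists_infinite_fiber
      (fun n : ℕ => fun l : Fin (K + N₀) => shift n y l)
    have hinf := infinite_coe_iff.1 hf
    obtain ⟨i, hi⟩ := hinf.nonempty
    obtain ⟨k₁, hik₁, hk₁⟩ := hlow i
    obtain ⟨k₂, hik₂, hk₂⟩ := hup i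
    obtain ⟨j, hj, hlt⟩ := hinf.exists_gt (max k₁ k₂)
    refine ⟨i, j, k₁, k₂, K + N₀, hik₁, hik₂, (le_max_left _ _).trans_lt hlt,
      (le_max_right _ _).trans_lt hlt, hk₁, hk₂, by omega, fun l hl => ?_, Or.inr fun n => ?_⟩
    · have e1 : (fun l : Fin (K + N₀) => shift i y l) = f := hi
      have e2 : (fun l : Fin (K + N₀) => shift j y l) = f := hj
      exact congrFun (e1.trans e2.symm) ⟨l, hl⟩
    · obtain ⟨l, hl, hne⟩ := hN₀ n
      exact ⟨l, by omega, hne⟩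
  · push Not at hacc
    obtain ⟨i, hi⟩ := hacc K
    obtain ⟨k₁, hik₁, hk₁⟩ := hlow i
    obtain ⟨k₂, hik₂, hk₂⟩ := hup i
    -- a close enough approach to `q` happens after any given time
    have hbd : ∀ M, ∃ N, ∀ n ≤ M, ∃ l < N, shift n y l ≠ q l := by
      intro M
      induction M with
      | zero =>
        obtain ⟨N, hN⟩ := (hq 0).exists_ne
        exact ⟨N, fun n hn => by obtain rfl : n = 0 := by omega
                                 exact hN⟩
      | succ M ih =>
        obtain ⟨N, hN⟩ := ih
        obtain ⟨N', l, hl, hne⟩ := (hq (M + 1)).exists_ne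
        refine ⟨N + N', fun n hn => ?_⟩
        rcases Nat.le_succ_iff.1 hn with h1 | rfl
        · obtain ⟨l, hl, hne⟩ := hN n h1
          exact ⟨l, by omega, hne⟩
        · exact ⟨l, by omega, hne⟩
    obtain ⟨N, hN⟩ := hbd (max k₁ k₂)
    obtain ⟨j, hj⟩ := hacc (K + N)
    have hlt : max k₁ k₂ < j := by
      by_contra hc
      obtain ⟨l, hl, hne⟩ := hN j (not_lt.1 hc)
      exact hne (hj l (by omega))
    obtain ⟨l, hl, hne⟩ := hN i (hik₁.trans (le_max_left _ _))
    refine ⟨i, j, k₁, k₂, K, hik₁, hik₂, (le_max_left _ _).trans_lt hlt,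
      (le_max_right _ _).trans_lt hlt, hk₁, hk₂, le_rfl, fun l hl => ?_, Or.inl ?_⟩
    · rw [hi l hl, hj l (by omega)]
    · exact (hq i).of_agree_right ⟨l, hl, hne⟩ fun l hl => hj l (by omega)

/-- The extreme points of a periodic orbit avoiding the closed hole `[s^∞, t^∞]` form an extremal
pair with a larger hole. -/
theorem exists_larger_extremal (hst : LexLT (per s) (per t)) {w : List Bool} (hw : w ≠ [])
    (hy : ∀ k, LexLT (shift k (per w)) (per s) ∨ LexLT (per t) (shift k (per w)))
    (hlow : ∃ k, LexLT (shift k (per w)) (per s)) (hup : ∃ k, LexLT (per t) (shift k (per w))) :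
    ∃ s' t', IsExtremal s' t' ∧ LexLT (per s') (per s) ∧ LexLT (per t) (per t') ∧
      ∃ k, per s' = shift k (per w) := by
  classical
  have hp := List.length_pos_iff.2 hw
  set L := (Finset.range w.length).filter fun k => LexLT (shift k (per w)) (per s)
  set U := (Finset.range w.length).filter fun k => LexLT (per t) (shift k (per w))
  have hL : L.Nonempty := by
    obtain ⟨k, hk⟩ := hlow
    rw [shift_per_mod] at hk
    exact ⟨k % w.length, Finset.mem_filter.2 ⟨Finset.mem_range.2 (Nat.mod_lt _ hp), hk⟩⟩
  have hU : U.Nonempty := by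
    obtain ⟨k, hk⟩ := hup
    rw [shift_per_mod] at hk
    exact ⟨k % w.length, Finset.mem_filter.2 ⟨Finset.mem_range.2 (Nat.mod_lt _ hp), hk⟩⟩
  obtain ⟨a, ha, hamax⟩ := L.exists_max_image (fun k => toLex (shift k (per w))) hL
  obtain ⟨b, hb, hbmin⟩ := U.exists_min_image (fun k => toLex (shift k (per w))) hU
  obtain ⟨s', hs', hsa⟩ := shift_per_isRotated w a
  obtain ⟨t', ht', htb⟩ := shift_per_isRotated w b
  have h1 : LexLT (per s') (per s) := by rw [← hsa]; exact (Finset.mem_filter.1 ha).2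
  have h2 : LexLT (per t) (per t') := by rw [← htb]; exact (Finset.mem_filter.1 hb).2
  refine ⟨s', t', ⟨hs'.symm.trans ht', h1.trans (hst.trans h2), fun k => ?_⟩, h1, h2, a, hsa.symm⟩
  rw [← hsa, ← htb, shift_shift, shift_per_mod]
  have hm := Finset.mem_range.2 (Nat.mod_lt (k + a) hp)
  have h3 := hy (k + a)
  rw [shift_per_mod] at h3
  refine h3.imp (fun h3 => ?_) fun h3 => ?_
  · exact lexLE_iff.2 (hamax _ (Finset.mem_filter.2 ⟨hm, h3⟩))
  · exact lexLE_iff.2 (hbmin _ (Finset.mem_filter.2 ⟨hm, h3⟩))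

/-- A greedy expansion whose orbit avoids the hole of a maximal extremal pair `(s, t)` ends in
`0^∞` or in `s^∞`. -/
theorem IsMaximal.eventually (hβ : β ∈ Ioo (1 : ℝ) 2) (h : IsMaximal β s t)
    (hgs : IsGreedy β (per s)) (hg : IsGreedy β y)
    (hy : ∀ n, ¬ (LexLT (per s) (shift n y) ∧ LexLT (shift n y) (per t))) :
    (∃ n, shift n y = fun _ => false) ∨ ∃ n, shift n y = per s := by
  by_contra hc
  push Not at hc
  obtain ⟨hne0, hnes⟩ := hc
  obtain ⟨hext, -, hside, hmax⟩ := h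
  have hb := hβ.1
  have hgt := hext.isGreedy_right hgs
  have hnet : ∀ n, shift n y ≠ per t := by
    intro n hn
    obtain ⟨k, hk⟩ := IsRotated.exists_shift hext.1.symm
    apply hnes (k + n)
    rw [← shift_shift, hn, hk]
  have hy' : ∀ n, LexLT (shift n y) (per s) ∨ LexLT (per t) (shift n y) := by
    intro n
    by_contra hcon
    push Not at hcon
    exact hy n ⟨(not_lexLT.1 hcon.1).lt_of_ne (hnes n).symm,
      (not_lexLT.1 hcon.2).lt_of_ne (hnet n)⟩
  have hpos : ∀ n, value β (shift n y) ∈ Ioo (0 : ℝ) 1 := by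
    intro n
    refine ⟨?_, hg n⟩
    obtain ⟨i, hi⟩ := Function.ne_iff.1 (hne0 n)
    exact value_pos hb (i := i) (by simpa using hi)
  have hup : ∀ n, ∃ m, n ≤ m ∧ LexLT (per t) (shift m y) := by
    intro n
    by_contra hcon
    push Not at hcon
    refine hside ⟨_, hpos n, Or.inl fun k => ?_⟩
    rw [(hg.shift n).iterate_T hb, shift_shift]
    exact ⟨value_nonneg hb _, ((hy' (k + n)).resolve_right (hcon _ (by omega))).value_lt' hb
      (hg.shift _)⟩
  have hlow : ∀ n, ∃ m, n ≤ m ∧ LexLT (shift m y) (per s) := by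
    intro n
    by_contra hcon
    push Not at hcon
    refine hside ⟨_, hpos n, Or.inr fun k => ?_⟩
    rw [(hg.shift n).iterate_T hb, shift_shift]
    exact ⟨((hy' (k + n)).resolve_left (hcon _ (by omega))).value_lt' hb hgt, hg _⟩
  obtain ⟨w, hw, hgw, hwy, hwl, hwu⟩ := hext.exists_periodic hβ hg hy' hlow hup
  obtain ⟨s', t', hext', hs', ht', k, hk⟩ := exists_larger_extremal hext.2.1 hw hwy hwl hwu
  have hgs' : IsGreedy β (per s') := by rw [hk]; exact hgw.shift k
  have h1 := hs'.value_lt' hb hgs'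
  have h2 := ht'.value_lt' hb hgt
  have h3 := hext.2.1.value_lt' hb hgs
  refine hmax ⟨s', t', hext', hgs'.admissible hβ, ?_⟩
  refine (ssubset_iff_of_subset (Ioo_subset_Ioo h1.le h2.le)).2 ⟨value β (per s), ?_, ?_⟩
  · exact ⟨h1, h3.trans h2⟩
  · simp

theorem IsGreedy.avoid_iff (hβ : β ∈ Ioo (1 : ℝ) 2) {a b : ℕ → Bool} (ha : IsGreedy β a)
    (hb : IsGreedy β b) (hy : IsGreedy β y) :
    (LexLT a y ∧ LexLT y b) ↔ value β y ∈ Ioo (value β a) (value β b) :=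
  ⟨fun h => ⟨h.1.value_lt' hβ.1 ha, h.2.value_lt' hβ.1 hy⟩,
    fun h => ⟨lexLT_of_value_lt hβ (hy.admissible hβ) h.1,
      lexLT_of_value_lt hβ (hb.admissible hβ) h.2⟩⟩

/-- The avoidance set of the hole of a maximal extremal pair. -/
theorem IsMaximal.essEq (hβ : β ∈ Ioo (1 : ℝ) 2) (h : IsMaximal β s t)
    (hgs : IsGreedy β (per s)) {x : ℝ} (hx : x ∈ J β (value β (per s)) (value β (per t))) :
    (∃ n, shift n (greedy β x) = fun _ => false) ∨ ∃ n, shift n (greedy β x) = per s := by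
  have hx' : x ∈ Ico (0 : ℝ) 1 := ⟨hx.1.1.le, hx.1.2⟩
  have hg := isGreedy_greedy hβ hx'
  refine h.eventually hβ hgs hg fun n hn => ?_
  rw [hgs.avoid_iff hβ (h.1.isGreedy_right hgs) (hg.shift n), ← hg.iterate_T hβ.1,
    value_greedy hβ ⟨hx'.1, hx'.2.le⟩] at hn
  exact hx.2 n hn

theorem greedy_zero : greedy β 0 = fun _ => false := by
  have hT : ∀ n, (T β)^[n] 0 = 0 := fun n => Function.iterate_fixed (by simp [T]) n
  funext i; simp [greedy, hT]

/-- If `1/β` lies in the hole of `(s, t)`, then no orbit in the avoidance set ends at `0`. -/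
theorem shift_greedy_ne_zero (hβ : β ∈ Ioo (1 : ℝ) 2) {a b x : ℝ} (hx : x ∈ J β a b)
    (hab : 1 / β ∈ Ioo a b) (n : ℕ) : shift n (greedy β x) ≠ fun _ => false := by
  have hb := hβ.1
  have hb0 : 0 < β := by linarith
  have hx' : x ∈ Ico (0 : ℝ) 1 := ⟨hx.1.1.le, hx.1.2⟩
  induction n with
  | zero =>
    intro h
    have := value_greedy hβ (z := x) ⟨hx'.1, hx'.2.le⟩
    rw [shift_zero] at h
    rw [h, value_zero] at this
    linarith [hx.1.1]
  | succ n ih =>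
    intro h
    have h0 : shift 1 (shift n (greedy β x)) = fun _ => false := by rw [shift_shift, add_comm, h]
    have h1 := value_eq hb (shift n (greedy β x))
    rw [h0, value_zero, shift_greedy] at h1
    have hT := iterate_T_mem (β := β) hx' n
    rw [value_greedy hβ ⟨hT.1, hT.2.le⟩, ← shift_greedy] at h1
    cases hd : shift n (greedy β x) 0
    · apply ih
      funext i
      cases i with
      | zero => exact hd
      | succ i => exact congrFun h0 i
    · rw [hd] at h1
      refine hx.2 n ?_
      rw [h1]
      simpa [dig] using hab

end BetaHole

namespace BetaHole

/-! ### Dominated words in the full shift -/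

variable {c d x y z : ℕ → Bool} {O O' : Set (ℕ → Bool)}

theorem countable_tails {S : Set (ℕ → Bool)} (hS : S.Countable) :
    {x | ∃ n, shift n x ∈ S}.Countable := by
  refine (countable_iUnion fun w : List Bool => hS.image (cat w)).mono ?_
  rintro x ⟨n, hn⟩
  exact mem_iUnion.2 ⟨pre n x, _, hn, cat_pre_shift n x⟩

/-- The word `c` is dominated by `O` if every tail following a letter `0` is at most some element of
`O` and every tail following a letter `1` is at least some element of `O`. When `O` is the orbit of
a periodic balanced word, these are the words avoiding the hole between its largest shift beginning
with `0` and its smallest shift beginning with `1`. -/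
def Dominated (O : Set (ℕ → Bool)) (c : ℕ → Bool) : Prop :=
  ∀ i, (c i = false → ∃ z ∈ O, LexLE (shift (i + 1) c) z) ∧
    (c i = true → ∃ z ∈ O, LexLE z (shift (i + 1) c))

theorem Dominated.mono (h : Dominated O c) (hO : O ⊆ O') : Dominated O' c := fun i =>
  ⟨fun hi => let ⟨z, hz, h'⟩ := (h i).1 hi; ⟨z, hO hz, h'⟩,
    fun hi => let ⟨z, hz, h'⟩ := (h i).2 hi; ⟨z, hO hz, h'⟩⟩

theorem eq_cat_shift_one (x : ℕ → Bool) : x = cat [x 0] (shift 1 x) := by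
  refine eq_cat_of_agree (w := [x 0]) fun i hi => ?_
  obtain rfl : i = 0 := by simpa using hi
  rfl

theorem lexLT_of_head (hx : x 0 = false) (hy : y 0 = true) : LexLT x y := ⟨0, by simp, hx, hy⟩

theorem lexLE_tail (h : LexLE x y) (h0 : x 0 = y 0) : LexLE (shift 1 x) (shift 1 y) := by
  rw [eq_cat_shift_one x, eq_cat_shift_one y, h0] at h
  exact lexLE_cat.1 h

theorem dominated_of_avoid (hx : x ∈ O) (hy : y ∈ O)
    (h : ∀ n, ¬ (LexLT (cat [false] x) (shift n c) ∧ LexLT (shift n c) (cat [true] y))) :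
    Dominated O c := by
  intro i
  constructor
  · intro hi
    refine ⟨x, hx, ?_⟩
    have h1 : LexLT (shift i c) (cat [true] y) := lexLT_of_head (by simpa [shift] using hi) (by simp)
    have h2 := not_lexLT.1 fun h' => h i ⟨h', h1⟩
    have h3 := lexLE_tail h2 (by simpa [shift] using hi)
    rwa [shift_shift, add_comm, shift_one_cat_cons, cat_nil] at h3
  · intro hi
    refine ⟨y, hy, ?_⟩
    have h1 : LexLT (cat [false] x) (shift i c) := lexLT_of_head (by simp) (by simpa [shift] using hi)
    have h2 := not_lexLT.1 fun h' => h i ⟨h1, h'⟩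
    have h3 := lexLE_tail h2 (by simpa [shift] using hi.symm)
    rwa [shift_shift, add_comm 1, shift_one_cat_cons, cat_nil] at h3

/-- Exchanging the letters `0` and `1`. -/
def negate (x : ℕ → Bool) : ℕ → Bool := fun i => ! x i

theorem negate_negate (x : ℕ → Bool) : negate (negate x) = x := by funext i; simp [negate]

theorem shift_negate (n : ℕ) (x : ℕ → Bool) : shift n (negate x) = negate (shift n x) := rfl

theorem lexLT_negate (h : LexLT x y) : LexLT (negate y) (negate x) := by
  obtain ⟨k, h, h0, h1⟩ := h
  exact ⟨k, fun i hi => by simp [negate, h i hi], by simp [negate, h1], by simp [negate, h0]⟩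

theorem lexLE_negate (h : LexLE x y) : LexLE (negate y) (negate x) := by
  rcases h with h | rfl
  · exact (lexLT_negate h).le
  · exact LexLE.refl _

theorem Dominated.negate (h : Dominated O c) : Dominated (negate '' O) (negate c) := by
  intro i
  constructor
  · intro hi
    obtain ⟨z, hz, h'⟩ := (h i).2 (by simpa [BetaHole.negate] using hi)
    exact ⟨_, mem_image_of_mem _ hz, by rw [shift_negate]; exact lexLE_negate h'⟩
  · intro hi
    obtain ⟨z, hz, h'⟩ := (h i).1 (by simpa [BetaHole.negate] using hi)
    exact ⟨_, mem_image_of_mem _ hz, by rw [shift_negate]; exact lexLE_negate h'⟩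

theorem countable_dominated_negate (h : {c | Dominated O c}.Countable) :
    {c | Dominated (negate '' O) c}.Countable := by
  refine (h.image negate).mono fun c hc => ?_
  have := Dominated.negate hc
  rw [← image_comp, show (negate ∘ negate) = id from funext negate_negate, image_id] at this
  exact ⟨negate c, this, negate_negate c⟩

theorem eq_false_of_lexLE (h : LexLE x fun _ => false) : x = fun _ => false := by
  rcases h with ⟨k, -, -, h⟩ | h
  · cases h
  · exact h

/-- For this set `O`, a letter `0` forces the word to end in `0^∞`. -/
theorem countable_dominated_base :
    {c | Dominated {(fun _ => false), cat [true] fun _ => false} c}.Countable := by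
  refine ((countable_tails (countable_singleton fun _ => false)).union
    (countable_singleton fun _ => true)).mono fun c hc => ?_
  by_cases h1 : ∃ i, c i = false
  · left
    obtain ⟨i, hi⟩ := h1
    by_cases h2 : ∃ j, c j = false ∧ c (j + 1) = true
    · obtain ⟨j, hj, hj'⟩ := h2
      refine ⟨j + 2, ?_⟩
      obtain ⟨z, hz, hle⟩ := (hc j).1 hj
      have hle' : LexLE (shift (j + 1) c) (cat [true] fun _ => false) := by
        rcases hz with rfl | rfl
        · exact hle.trans (lexLT_of_head rfl (by simp)).le
        · exact hle
      have := lexLE_tail hle' (by simpa [shift] using hj')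
      rw [shift_shift, shift_one_cat_cons, cat_nil, show 1 + (j + 1) = j + 2 by ring] at this
      exact eq_false_of_lexLE this
    · push Not at h2
      refine ⟨i, funext fun k => ?_⟩
      rw [shift_apply, add_comm]
      induction k with
      | zero => exact hi
      | succ k ih => simpa [add_assoc] using h2 _ ih
  · right
    push Not at h1
    exact funext fun i => by simpa using h1 i

/-! ### Renormalization by the substitution `0 ↦ 0`, `1 ↦ 10` -/

/-- Letter `n` of the image of an infinite word under the substitution `0 ↦ 0`, `1 ↦ 10`. -/
def subLAux : ℕ → (ℕ → Bool) → Bool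
  | 0, z => z 0
  | 1, z => if z 0 then false else subLAux 0 (shift 1 z)
  | n + 2, z => if z 0 then subLAux n (shift 1 z) else subLAux (n + 1) (shift 1 z)

/-- The substitution `0 ↦ 0`, `1 ↦ 10` on infinite words. -/
def subL (z : ℕ → Bool) : ℕ → Bool := fun n => subLAux n z

theorem subL_eq (z : ℕ → Bool) :
    subL z = cat (if z 0 then [true, false] else [false]) (subL (shift 1 z)) := by
  funext n
  match n with
  | 0 => cases h : z 0 <;> simp [subL, subLAux, cat, h]
  | 1 => cases h : z 0 <;> simp [subL, subLAux, cat, h]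
  | n + 2 => cases h : z 0 <;> simp [subL, subLAux, cat, h]

theorem subL_of_false (h : z 0 = false) : subL z = cat [false] (subL (shift 1 z)) := by
  rw [subL_eq, h]; rfl

theorem subL_of_true (h : z 0 = true) :
    subL z = cat [true] (cat [false] (subL (shift 1 z))) := by
  rw [subL_eq, h, ← cat_append]; rfl

theorem subL_zero (z : ℕ → Bool) : subL z 0 = z 0 := rfl

theorem lexLT_subL (h : LexLT x y) : LexLT (subL x) (subL y) := by
  obtain ⟨k, h, h0, h1⟩ := h
  induction k generalizing x y with
  | zero => exact lexLT_of_head h0 h1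
  | succ k ih =>
    rw [subL_eq x, subL_eq y, h 0 (by omega), lexLT_cat]
    exact ih (fun i hi => h (i + 1) (by omega)) h0 h1

theorem lexLE_subL_iff : LexLE (subL x) (subL y) ↔ LexLE x y := by
  constructor
  · intro h
    by_contra hc
    exact LexLT.irrefl _ ((lexLT_subL (not_lexLE.1 hc)).trans_le h)
  · rintro (h | rfl)
    · exact (lexLT_subL h).le
    · exact LexLE.refl _

theorem exists_shift_subL (z : ℕ → Bool) (k : ℕ) : ∃ p, shift p (subL z) = subL (shift k z) := by
  induction k with
  | zero => exact ⟨0, rfl⟩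
  | succ k ih =>
    obtain ⟨p, hp⟩ := ih
    rw [subL_eq (shift k z), shift_shift, add_comm 1] at hp
    exact ⟨_, by rw [← shift_shift, hp, shift_length_cat]⟩

/-- The tails of the image of a word under the substitution `0 ↦ 0`, `1 ↦ 10`. -/
theorem shift_subL (z : ℕ → Bool) (j : ℕ) : (∃ k, shift j (subL z) = subL (shift k z)) ∨
    ∃ k, z k = true ∧ shift j (subL z) = cat [false] (subL (shift (k + 1) z)) := by
  induction j with
  | zero => exact Or.inl ⟨0, rfl⟩
  | succ j ih =>
    rw [add_comm, ← shift_shift]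
    rcases ih with ⟨k, hk⟩ | ⟨k, -, hk⟩
    · rw [hk]
      cases h : z k
      · left
        refine ⟨k + 1, ?_⟩
        rw [subL_of_false (z := shift k z) (by simpa [shift] using h), shift_one_cat_cons,
          cat_nil, shift_shift, add_comm]
      · right
        refine ⟨k, h, ?_⟩
        rw [subL_of_true (z := shift k z) (by simpa [shift] using h), shift_one_cat_cons,
          cat_nil, shift_shift, add_comm]
    · left
      exact ⟨k + 1, by rw [hk, shift_one_cat_cons, cat_nil]⟩

/-- Removing the first block `0` or `10`. -/
def unblock (d : ℕ → Bool) : ℕ → Bool := shift (if d 0 then 2 else 1) d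

/-- The preimage of a word without factor `11` under the substitution `0 ↦ 0`, `1 ↦ 10`. -/
def desub (d : ℕ → Bool) : ℕ → Bool := fun k => (unblock^[k] d) 0

theorem subL_desub (h : ∀ i, d i = true → d (i + 1) = false) : subL (desub d) = d := by
  have key : ∀ m (d : ℕ → Bool), (∀ i, d i = true → d (i + 1) = false) →
      subL (desub d) m = d m := by
    intro m
    induction m using Nat.strong_induction_on with
    | _ m ih =>
    intro d h
    have h0 : desub d 0 = d 0 := rfl
    have h1 : shift 1 (desub d) = desub (unblock d) := rfl
    have h2 : d = cat (if d 0 then [true, false] else [false]) (unblock d) := by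
      cases hd : d 0
      · have := eq_cat_shift_one d
        rw [hd] at this
        simpa [unblock, hd] using this
      · have := eq_cat_of_agree (x := d) (w := [true, false]) fun i hi => by
          rcases i with _ | _ | i
          · exact hd
          · exact h 0 hd
          · simp at hi
        simpa [unblock, hd] using this
    have h3 : ∀ i, unblock d i = true → unblock d (i + 1) = false := fun i hi => by
      have := h _ hi
      rwa [add_right_comm] at this
    rw [subL_eq, h0, h1]
    set B := if d 0 then [true, false] else [false] with hB
    have hBpos : 0 < B.length := by rw [hB]; split_ifs <;> simp
    conv_rhs => rw [h2]
    rcases lt_or_ge m B.length with hm | hm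
    · exact cat_congr hm _ _
    · obtain ⟨l, rfl⟩ := Nat.exists_eq_add_of_le' hm
      rw [cat_apply_add, cat_apply_add]
      exact ih l (by omega) _ h3
  exact funext fun m => key m d h

/-- Words dominated by the image of a set `O'` are, from some point on, images of words dominated
by `O'`. -/
theorem Dominated.desub (hO' : ∀ z ∈ O', shift 1 z ∈ O')
    (hO : ∀ x ∈ O, (∃ z ∈ O', x = subL z) ∨
      ∃ z ∈ O', z 0 = true ∧ x = cat [false] (subL (shift 1 z)))
    (hc : Dominated O c) :
    c = (fun _ => true) ∨ ∃ n c', shift n c = subL c' ∧ Dominated O' c' := by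
  by_cases h1 : ∃ i, c i = false
  swap
  · left
    push Not at h1
    exact funext fun i => by simpa using h1 i
  right
  obtain ⟨i, hi⟩ := h1
  have hx11 : ∀ x ∈ O, x 0 = true → x 1 = false := by
    intro x hx hx0
    rcases hO x hx with ⟨z, -, rfl⟩ | ⟨z, -, -, rfl⟩
    · rw [subL_of_true (z := z) hx0]; simp [cat]
    · simp at hx0
  have hno : ∀ j, c (i + j) = false ∨ (c (i + j) = true ∧ c (i + j + 1) = false) := by
    intro j
    induction j with
    | zero => exact Or.inl hi
    | succ j ih =>
      rcases ih with h2 | ⟨-, h2⟩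
      · by_cases h3 : c (i + (j + 1)) = true
        · right
          refine ⟨h3, ?_⟩
          obtain ⟨x, hx, hle⟩ := (hc (i + j)).1 h2
          by_contra h4
          have h4 : c (i + (j + 1) + 1) = true := by simpa using h4
          have e0 : shift (i + j + 1) c 0 = true := by rw [shift_apply, ← h3]; congr 1; ring
          have e1 : shift (i + j + 1) c 1 = true := by rw [shift_apply, ← h4]; congr 1; ring
          have hx0 : x 0 = true := by
            by_contra hx0
            exact LexLT.irrefl _ ((lexLT_of_head (by simpa using hx0) e0).trans_le hle)
          have h5 := lexLE_tail hle (by rw [e0, hx0])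
          exact LexLT.irrefl _ ((lexLT_of_head (x := shift 1 x) (hx11 x hx hx0)
            (y := shift 1 (shift (i + j + 1) c)) e1).trans_le h5)
        · left; simpa using h3
      · left; exact h2
  set n := i + 1
  have hd : subL (BetaHole.desub (shift n c)) = shift n c := by
    refine subL_desub fun k hk => ?_
    rcases hno (k + 1) with h2 | ⟨-, h2⟩
    · exfalso
      have e : i + (k + 1) = k + n := by simp only [n]; ring
      rw [e] at h2
      rw [shift_apply, h2] at hk; cases hk
    · have e : i + (k + 1) + 1 = k + 1 + n := by simp only [n]; ring
      rw [e] at h2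
      exact h2
  set c' := BetaHole.desub (shift n c)
  refine ⟨n, c', hd.symm, fun k => ?_⟩
  obtain ⟨p, hp⟩ := exists_shift_subL c' k
  rw [hd, shift_shift] at hp
  have hck : c (p + n) = c' k := by
    have := congrFun hp 0
    rw [shift_apply, zero_add, subL_zero, shift_apply, zero_add] at this
    exact this
  constructor
  · intro hk
    obtain ⟨x, hx, hle⟩ := (hc (p + n)).1 (hck.trans hk)
    have e : shift (p + n + 1) c = subL (shift (k + 1) c') := by
      rw [add_comm, ← shift_shift, hp, subL_of_false (z := shift k c') (by simpa [shift] using hk),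
        shift_one_cat_cons, cat_nil, shift_shift, add_comm]
    rw [e] at hle
    rcases hO x hx with ⟨z, hz, rfl⟩ | ⟨z, hz, hz0, rfl⟩
    · exact ⟨z, hz, lexLE_subL_iff.1 hle⟩
    · refine ⟨z, hz, lexLE_subL_iff.1 (hle.trans (LexLT.le ?_))⟩
      exact lexLT_of_head (y := subL z) (by simp) hz0
  · intro hk
    obtain ⟨x, hx, hle⟩ := (hc (p + n)).2 (hck.trans hk)
    have e : shift (p + n + 1) c = cat [false] (subL (shift (k + 1) c')) := by
      rw [add_comm, ← shift_shift, hp, subL_of_true (z := shift k c') (by simpa [shift] using hk),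
        shift_one_cat_cons, cat_nil, shift_shift, add_comm]
    rw [e] at hle
    rcases hO x hx with ⟨z, hz, rfl⟩ | ⟨z, hz, hz0, rfl⟩
    · have hz0 : z 0 = false := by
        by_contra hz0
        exact LexLT.irrefl _ ((lexLT_of_head (y := subL z) (by simp)
          ((subL_zero z).trans (by simpa using hz0))).trans_le hle)
      rw [subL_of_false hz0, lexLE_cat, lexLE_subL_iff] at hle
      exact ⟨_, hO' z hz, hle⟩
    · rw [lexLE_cat, lexLE_subL_iff] at hle
      exact ⟨_, hO' z hz, hle⟩

theorem countable_dominated_subL (hO' : ∀ z ∈ O', shift 1 z ∈ O')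
    (hO : ∀ x ∈ O, (∃ z ∈ O', x = subL z) ∨
      ∃ z ∈ O', z 0 = true ∧ x = cat [false] (subL (shift 1 z)))
    (h : {c | Dominated O' c}.Countable) : {c | Dominated O c}.Countable := by
  refine ((countable_singleton fun _ => true).union
    (countable_tails (h.image subL))).mono fun c hc => ?_
  rcases Dominated.desub hO' hO hc with h1 | ⟨n, c', h1, h2⟩
  · exact Or.inl h1
  · exact Or.inr ⟨n, by rw [h1]; exact mem_image_of_mem _ h2⟩

/-! ### Farey words -/

/-- The orbit of the periodic word `w^∞` under the shift. -/
def orbit (w : List Bool) : Set (ℕ → Bool) := {x | ∃ j, x = shift j (per w)}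

theorem shift_mem_orbit {w : List Bool} (n : ℕ) (h : x ∈ orbit w) : shift n x ∈ orbit w := by
  obtain ⟨j, rfl⟩ := h
  exact ⟨n + j, shift_shift _ _ _⟩

theorem orbit_subset_of_isRotated {w w' : List Bool} (h : List.IsRotated w w') :
    orbit w' ⊆ orbit w := by
  rintro _ ⟨j, rfl⟩
  obtain ⟨n, hn⟩ := IsRotated.exists_shift h
  exact ⟨j + n, by rw [hn, shift_shift]⟩

theorem orbit_eq_of_isRotated {w w' : List Bool} (h : List.IsRotated w w') : orbit w = orbit w' :=
  (orbit_subset_of_isRotated h.symm).antisymm (orbit_subset_of_isRotated h)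

theorem subst_cons (s t : List Bool) (b : Bool) (w : List Bool) :
    subst s t (b :: w) = (if b then t else s) ++ subst s t w := by simp [subst]

theorem subst_append (s t w w' : List Bool) :
    subst s t (w ++ w') = subst s t w ++ subst s t w' := by simp [subst]

theorem subst_ne_nil {s t w : List Bool} (hs : s ≠ []) (ht : t ≠ []) (hw : w ≠ []) :
    subst s t w ≠ [] := by
  cases w with
  | nil => exact absurd rfl hw
  | cons b w => rw [subst_cons]; cases b <;> simp [hs, ht]

theorem subL_cat (w : List Bool) (x : ℕ → Bool) :
    subL (cat w x) = cat (subst [false] [true, false] w) (subL x) := by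
  induction w with
  | nil => simp [subst]
  | cons b w ih =>
    rw [subL_eq, shift_one_cat_cons, ih, cat_cons_zero, subst_cons, cat_append]

theorem subL_per {w : List Bool} (hw : w ≠ []) :
    subL (per w) = per (subst [false] [true, false] w) := by
  apply eq_per_of_eq_cat (subst_ne_nil (by simp) (by simp) hw)
  conv_lhs => rw [per_eq_cat, subL_cat]

theorem countable_dominated_left {w : List Bool} (hw : w ≠ [])
    (h : {c | Dominated (orbit w) c}.Countable) :
    {c | Dominated (orbit (subst [false] [true, false] w)) c}.Countable := by
  refine countable_dominated_subL (fun z hz => shift_mem_orbit 1 hz) ?_ h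
  rintro _ ⟨j, rfl⟩
  rw [← subL_per hw]
  rcases shift_subL (per w) j with ⟨k, hk⟩ | ⟨k, hk, hk'⟩
  · exact Or.inl ⟨_, ⟨k, rfl⟩, hk⟩
  · refine Or.inr ⟨_, ⟨k, rfl⟩, by simpa [shift] using hk, ?_⟩
    rw [hk', shift_shift, add_comm]

theorem negate_cat (w : List Bool) (x : ℕ → Bool) : negate (cat w x) = cat (w.map not) (negate x) := by
  funext i
  rcases lt_or_ge i w.length with h | h
  · rw [cat_apply_lt (by simpa using h)]
    simp [negate, cat_apply_lt h]
  · obtain ⟨m, rfl⟩ := Nat.exists_eq_add_of_le' h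
    have := cat_apply_add (w.map not) m (negate x)
    rw [List.length_map] at this
    rw [this]
    simp [negate, cat_apply_add]

theorem per_map_not {w : List Bool} (hw : w ≠ []) : per (w.map not) = negate (per w) := by
  symm
  apply eq_per_of_eq_cat (by simpa using hw)
  rw [← negate_cat, ← per_eq_cat]

theorem orbit_map_not {w : List Bool} (hw : w ≠ []) : orbit (w.map not) = negate '' orbit w := by
  ext x
  constructor
  · rintro ⟨j, rfl⟩
    exact ⟨_, ⟨j, rfl⟩, by rw [per_map_not hw, shift_negate]⟩
  · rintro ⟨_, ⟨j, rfl⟩, rfl⟩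
    exact ⟨j, by rw [per_map_not hw, shift_negate]⟩

theorem subst_map_not (w : List Bool) :
    (subst [false] [true, false] (w.map not)).map not = subst [false, true] [true] w := by
  induction w with
  | nil => rfl
  | cons b w ih =>
    rw [List.map_cons, subst_cons, subst_cons, List.map_append, ih]
    cases b <;> rfl

/-- The substitutions `0 ↦ 10`, `1 ↦ 1` and `0 ↦ 01`, `1 ↦ 1` are conjugate. -/
theorem isRotated_subst (w : List Bool) :
    List.IsRotated (subst [false, true] [true] w) (subst [true, false] [true] w) := by
  have h : ∀ w, [true] ++ subst [false, true] [true] w = subst [true, false] [true] w ++ [true] := by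
    intro w
    induction w with
    | nil => rfl
    | cons b w ih =>
      rw [subst_cons, subst_cons, List.append_assoc, ← ih]
      cases b <;> rfl
  cases w with
  | nil => exact List.IsRotated.refl _
  | cons b w =>
    obtain ⟨r, hr⟩ : ∃ r, subst [true, false] [true] (b :: w) = [true] ++ r := by
      rw [subst_cons]; cases b
      · exact ⟨[false] ++ subst [true, false] [true] w, rfl⟩
      · exact ⟨subst [true, false] [true] w, rfl⟩
    have h1 := h (b :: w)
    rw [hr, List.append_assoc] at h1
    rw [hr, List.append_cancel_left h1]
    exact isRotated_append _ _

theorem countable_dominated_right {w : List Bool} (hw : w ≠ [])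
    (h : {c | Dominated (orbit w) c}.Countable) :
    {c | Dominated (orbit (subst [true, false] [true] w)) c}.Countable := by
  have hw' : w.map not ≠ [] := by simpa using hw
  rw [← orbit_eq_of_isRotated (isRotated_subst w), ← subst_map_not,
    orbit_map_not (subst_ne_nil (by simp) (by simp) hw')]
  apply countable_dominated_negate
  apply countable_dominated_left hw'
  rw [orbit_map_not hw]
  exact countable_dominated_negate h

/-- The pairs of neighbouring Farey words, generated from the root of the tree by the two
substitutions `0 ↦ 0`, `1 ↦ 10` and `0 ↦ 10`, `1 ↦ 1`. -/
inductive SubstNeighbours : List Bool → List Bool → Prop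
  | root : SubstNeighbours [false] [true]
  | left {w₁ w₂ : List Bool} : SubstNeighbours w₁ w₂ →
      SubstNeighbours (subst [false] [true, false] w₁) (subst [false] [true, false] w₂)
  | right {w₁ w₂ : List Bool} : SubstNeighbours w₁ w₂ →
      SubstNeighbours (subst [true, false] [true] w₁) (subst [true, false] [true] w₂)

theorem SubstNeighbours.children {w₁ w₂ : List Bool} (h : SubstNeighbours w₁ w₂) :
    SubstNeighbours w₁ (w₂ ++ w₁) ∧ SubstNeighbours (w₂ ++ w₁) w₂ := by
  induction h with
  | root => exact ⟨SubstNeighbours.left .root, SubstNeighbours.right .root⟩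
  | left _ ih => rw [← subst_append]; exact ⟨.left ih.1, .left ih.2⟩
  | right _ ih => rw [← subst_append]; exact ⟨.right ih.1, .right ih.2⟩

theorem FareyNeighbours.substNeighbours {w₁ w₂ : List Bool} (h : FareyNeighbours w₁ w₂) :
    SubstNeighbours w₁ w₂ := by
  induction h with
  | root => exact .root
  | left _ ih => exact ih.children.1
  | right _ ih => exact ih.children.2

theorem per_singleton (b : Bool) : per [b] = fun _ => b := by funext i; simp [per, Nat.mod_one]

theorem countable_dominated_false : {c | Dominated (orbit [false]) c}.Countable := by
  refine countable_dominated_base.mono fun c hc => Dominated.mono hc ?_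
  rintro _ ⟨j, rfl⟩
  rw [per_singleton]; exact Or.inl rfl

theorem SubstNeighbours.countable {w₁ w₂ : List Bool} (h : SubstNeighbours w₁ w₂) :
    w₁ ≠ [] ∧ w₂ ≠ [] ∧ {c | Dominated (orbit w₁) c}.Countable ∧
      {c | Dominated (orbit w₂) c}.Countable := by
  induction h with
  | root =>
    refine ⟨by simp, by simp, countable_dominated_false, ?_⟩
    have := countable_dominated_negate countable_dominated_false
    rwa [← orbit_map_not (by simp)] at this
  | left _ ih =>
    obtain ⟨h1, h2, h3, h4⟩ := ih
    exact ⟨subst_ne_nil (by simp) (by simp) h1, subst_ne_nil (by simp) (by simp) h2,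
      countable_dominated_left h1 h3, countable_dominated_left h2 h4⟩
  | right _ ih =>
    obtain ⟨h1, h2, h3, h4⟩ := ih
    exact ⟨subst_ne_nil (by simp) (by simp) h1, subst_ne_nil (by simp) (by simp) h2,
      countable_dominated_right h1 h3, countable_dominated_right h2 h4⟩

/-- Only countably many words are dominated by the orbit of a periodic balanced word. -/
theorem IsFareyWord.countable_dominated {w : List Bool} (h : IsFareyWord w) :
    {c | Dominated (orbit w) c}.Countable := by
  obtain ⟨w₁, w₂, h, rfl⟩ := h
  exact h.substNeighbours.children.1.countable.2.2.2

end BetaHole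

namespace BetaHole

/-! ### Trapping and Farey descendants -/

variable {β : ℝ} {S R : List Bool} {c d x y z : ℕ → Bool}

/-- The greedy expansions whose orbits avoid the lexicographic interval `(p, q)`. -/
def avoiders (β : ℝ) (p q : ℕ → Bool) : Set (ℕ → Bool) :=
  {y | IsGreedy β y ∧ ∀ n, ¬ (LexLT p (shift n y) ∧ LexLT (shift n y) q)}

theorem eq_cat_of_between {w : List Bool} (h1 : LexLE (cat w x) z) (h2 : LexLE z (cat w y)) :
    z = cat w (shift w.length z) := by
  have hz := cat_pre_shift w.length z
  rcases h1 with h1 | h1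
  · rw [← hz] at h1
    rcases LexLT.wordLT_or (by simp) h1 with h3 | ⟨h3, -⟩
    · have := (h3.cat y (shift w.length z)).trans_le (by rwa [hz])
      exact absurd this (LexLT.irrefl _)
    · conv_lhs => rw [← hz, ← h3]
  · rw [← h1, shift_length_cat]

theorem lexLE_true (x : ℕ → Bool) : LexLE x fun _ => true := by
  rw [← not_lexLT]
  rintro ⟨k, -, h, -⟩
  cases h

theorem false_lexLE (x : ℕ → Bool) : LexLE (fun _ => false) x := by
  rw [← not_lexLT]
  rintro ⟨k, -, -, h⟩
  cases h

theorem lexLE_blk (hl : S.length = R.length) (hSR : WordLT S R) (h : LexLE c d) :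
    LexLE (blk S R c) (blk S R d) := by
  rcases h with h | rfl
  · exact (lexLT_blk hl hSR h).le
  · exact LexLE.refl _

theorem WordLT.ne_nil (h : WordLT S R) : S ≠ [] := by
  rintro rfl; obtain ⟨k, ha, -⟩ := h; simp at ha

theorem WordLT.append (h : WordLT S R) (a b : List Bool) : WordLT (S ++ a) (R ++ b) := by
  obtain ⟨k, ha, hb, h, h0, h1⟩ := h
  refine ⟨k, by simp; omega, by simp; omega, fun i hi => ?_, ?_, ?_⟩
  · rw [List.getElem_append_left (by omega), List.getElem_append_left (by omega), h i hi]
  · rw [List.getElem_append_left ha, h0]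
  · rw [List.getElem_append_left hb, h1]

theorem eq_blk_of_forall_cat (hS : S ≠ []) (hl : S.length = R.length)
    (h : ∀ k, shift (k * S.length) y =
      cat (if c k then R else S) (shift ((k + 1) * S.length) y)) : y = blk S R c := by
  funext i
  have hp := List.length_pos_iff.2 hS
  have hm := Nat.mod_lt i hp
  have h1 := congrFun (h (i / S.length)) (i % S.length)
  rw [shift_apply, Nat.mod_add_div'] at h1
  rw [h1]
  have h2 : (if c (i / S.length) then R else S).length = S.length := by split_ifs <;> simp [hl]
  simp only [cat, blk, h2, hm, if_true]

/-- Trapping: an orbit avoiding a hole `(S x, R y)`, with `x`, `y` concatenations of `S` and `R`,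
which enters the larger hole `(S^∞, R^∞)`, stays there when it is shifted by `|S|` letters at a
time. Hence, unless it meets `S^∞` or `R^∞`, it is a concatenation of the words `S` and `R` from
then on. -/
theorem eq_blk_of_trapped (hl : S.length = R.length) (hSR : WordLT S R)
    (havoid : ∀ n, ¬ (LexLT (blk S R (cat [false] c)) (shift n y) ∧
      LexLT (shift n y) (blk S R (cat [true] d))))
    (h1 : LexLT (per S) y) (h2 : LexLT y (per R))
    (hne : ∀ m, shift m y ≠ per S ∧ shift m y ≠ per R) : ∃ e, y = blk S R e := by
  have hS := hSR.ne_nil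
  have h0 : blk S R (fun _ => false) = per S := blk_const hl hS false
  have h0' : blk S R (fun _ => true) = per R := blk_const hl hS true
  have hc := blk_cat_cons hl hS false c
  have hd := blk_cat_cons hl hS true d
  simp only [Bool.false_eq_true, if_false, if_true] at hc hd
  have hstep : ∀ m, LexLT (per S) (shift m y) → LexLT (shift m y) (per R) →
      ∃ b : Bool, shift m y = cat (if b then R else S) (shift (S.length + m) y) ∧
        LexLT (per S) (shift (S.length + m) y) ∧ LexLT (shift (S.length + m) y) (per R) := by
    intro m hm1 hm2
    by_cases hp : LexLT (blk S R (cat [false] c)) (shift m y)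
    · have hq := not_lexLT.1 fun h => havoid m ⟨hp, h⟩
      rw [hd] at hq
      have e := eq_cat_of_between hq (y := per R) (by rw [← per_eq_cat]; exact hm2.le)
      rw [shift_shift, ← hl] at e
      refine ⟨true, e, ?_, ?_⟩
      · rw [e, lexLE_cat] at hq
        refine LexLE.lt_of_ne (LexLE.trans ?_ hq) (hne _).1.symm
        rw [← h0]
        exact lexLE_blk hl hSR (false_lexLE d)
      · rwa [e, per_eq_cat, lexLT_cat] at hm2
    · have hq := not_lexLT.1 hp
      rw [hc] at hq
      have e := eq_cat_of_between (x := per S) (by rw [← per_eq_cat]; exact hm1.le) hq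
      rw [shift_shift] at e
      refine ⟨false, e, ?_, ?_⟩
      · rwa [e, per_eq_cat, lexLT_cat] at hm1
      · rw [e, lexLE_cat] at hq
        refine LexLE.lt_of_ne (LexLE.trans hq ?_) (hne _).2
        rw [← h0']
        exact lexLE_blk hl hSR (lexLE_true c)
  have hin : ∀ k, LexLT (per S) (shift (k * S.length) y) ∧
      LexLT (shift (k * S.length) y) (per R) := by
    intro k
    induction k with
    | zero => simpa using ⟨h1, h2⟩
    | succ k ih =>
      obtain ⟨-, -, h⟩ := hstep _ ih.1 ih.2
      rwa [add_mul, one_mul, add_comm]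
  have hall : ∀ k, ∃ b : Bool, shift (k * S.length) y =
      cat (if b then R else S) (shift ((k + 1) * S.length) y) := by
    intro k
    obtain ⟨b, h, -⟩ := hstep _ (hin k).1 (hin k).2
    exact ⟨b, by rw [h, add_mul, one_mul, add_comm S.length]⟩
  choose e he using hall
  exact ⟨e, eq_blk_of_forall_cat hS hl he⟩

theorem countable_avoiders_of_trap (hl : S.length = R.length) (hSR : WordLT S R)
    {O : Set (ℕ → Bool)} (hO : {c | Dominated O c}.Countable) (hc : c ∈ O) (hd : d ∈ O)
    (h : (avoiders β (per S) (per R)).Countable) :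
    (avoiders β (blk S R (cat [false] c)) (blk S R (cat [true] d))).Countable := by
  have hS := hSR.ne_nil
  refine (h.union ((countable_tails (((countable_singleton (per R)).insert (per S)))).union
    (countable_tails (hO.image (blk S R))))).mono fun y hy => ?_
  by_cases hin : ∀ n, ¬ (LexLT (per S) (shift n y) ∧ LexLT (shift n y) (per R))
  · exact Or.inl ⟨hy.1, hin⟩
  right
  push Not at hin
  obtain ⟨n, h1, h2⟩ := hin
  by_cases hne : ∀ m, shift m (shift n y) ≠ per S ∧ shift m (shift n y) ≠ per R
  · right
    have hav : ∀ m, ¬ (LexLT (blk S R (cat [false] c)) (shift m (shift n y)) ∧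
        LexLT (shift m (shift n y)) (blk S R (cat [true] d))) := by
      intro m; rw [shift_shift]; exact hy.2 _
    obtain ⟨e, he⟩ := eq_blk_of_trapped hl hSR hav h1 h2 hne
    refine ⟨n, e, dominated_of_avoid hc hd fun m hm => hav (m * S.length) ?_, he.symm⟩
    rw [he, shift_blk hl hS]
    exact ⟨lexLT_blk hl hSR hm.1, lexLT_blk hl hSR hm.2⟩
  · left
    push Not at hne
    obtain ⟨m, hm⟩ := hne
    refine ⟨m + n, ?_⟩
    rw [← shift_shift]
    by_cases h3 : shift m (shift n y) = per S
    · exact Or.inl h3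
    · exact Or.inr (hm h3)

theorem blk_cat (hl : S.length = R.length) (hS : S ≠ []) (w : List Bool) (c : ℕ → Bool) :
    blk S R (cat w c) = cat (subst S R w) (blk S R c) := by
  induction w with
  | nil => simp [subst]
  | cons b w ih =>
    rw [subst_cons, cat_append, ← ih, ← blk_cat_cons hl hS, ← cat_append]; rfl

theorem WordLT.ne_nil_right (h : WordLT S R) : R ≠ [] := by
  rintro rfl; obtain ⟨k, -, hb, -⟩ := h; simp at hb

theorem blk_per (hl : S.length = R.length) (hS : S ≠ []) {w : List Bool} (hw : w ≠ []) :
    blk S R (per w) = per (subst S R w) := by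
  have hR : R ≠ [] := by rintro rfl; simp at hl; exact hS hl
  apply eq_per_of_eq_cat (subst_ne_nil hS hR hw)
  rw [← blk_cat hl hS, ← per_eq_cat]

theorem length_subst (hl : S.length = R.length) (w : List Bool) :
    (subst S R w).length = w.length * S.length := by
  induction w with
  | nil => simp [subst]
  | cons b w ih => rw [subst_cons, List.length_append, ih, List.length_cons]; cases b <;>
      simp [hl, add_mul, add_comm]

theorem subst_subst (S R a b w : List Bool) :
    subst S R (subst a b w) = subst (subst S R a) (subst S R b) w := by
  induction w with
  | nil => rfl
  | cons c w ih => rw [subst_cons, subst_append, ih, subst_cons]; cases c <;> rfl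

theorem IsBalancedDescendant.heads {s t : List Bool} (h : IsBalancedDescendant s t) :
    s.length = t.length ∧ (∃ s', s = false :: s') ∧ ∃ t', t = true :: t' := by
  induction h with
  | nil => exact ⟨rfl, ⟨_, rfl⟩, ⟨_, rfl⟩⟩
  | cons hw ha hb _ ih =>
    obtain ⟨hl, ⟨s', rfl⟩, ⟨t', rfl⟩⟩ := ih
    obtain ⟨ha1, ⟨a', rfl⟩, -⟩ := ha
    obtain ⟨hb1, ⟨b', rfl⟩, -⟩ := hb
    have hab := ha1.perm.length_eq.symm.trans hb1.perm.length_eq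
    refine ⟨by rw [length_subst hab, length_subst hab, hl], ?_, ?_⟩
    · rw [subst_cons]; exact ⟨_, rfl⟩
    · rw [subst_cons]; exact ⟨_, rfl⟩

/-- Passing to a Farey descendant, one substitution at a time, keeps the avoidance set
countable. -/
theorem IsBalancedDescendant.countable_avoiders {s t : List Bool} (h : IsBalancedDescendant s t)
    (hl : S.length = R.length) (hSR : WordLT S R)
    (hc : (avoiders β (per S) (per R)).Countable) :
    (avoiders β (per (subst S R s)) (per (subst S R t))).Countable := by
  induction h generalizing S R with
  | nil => simpa [subst] using hc
  | cons hw ha hb _ ih =>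
    obtain ⟨ha1, ⟨a', rfl⟩, -⟩ := ha
    obtain ⟨hb1, ⟨b', rfl⟩, -⟩ := hb
    have hab := ha1.perm.length_eq.symm.trans hb1.perm.length_eq
    rw [subst_subst, subst_subst]
    refine ih ?_ ?_ ?_
    · rw [length_subst hl, length_subst hl, hab]
    · simp only [List.cons_append, List.nil_append, subst_cons]
      exact hSR.append _ _
    · have hS := hSR.ne_nil
      rw [← blk_per hl hS (by simp), ← blk_per hl hS (by simp),
        eq_cat_shift_one (per ([false] ++ a')), eq_cat_shift_one (per ([true] ++ b'))]
      have e1 : per ([false] ++ a') 0 = false := by rw [per_eq_cat]; rfl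
      have e2 : per ([true] ++ b') 0 = true := by rw [per_eq_cat]; rfl
      rw [e1, e2]
      refine countable_avoiders_of_trap hl hSR hw.countable_dominated ?_ ?_ hc
      · rw [orbit_eq_of_isRotated ha1]; exact ⟨1, rfl⟩
      · rw [orbit_eq_of_isRotated hb1]; exact ⟨1, rfl⟩

theorem IsMaximal.countable_avoiders (hβ : β ∈ Ioo (1 : ℝ) 2) {s t : List Bool}
    (h : IsMaximal β s t) (hgs : IsGreedy β (per s)) :
    (avoiders β (per s) (per t)).Countable := by
  refine (countable_tails ((countable_singleton (per s)).insert fun _ => false)).mono fun y hy => ?_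
  rcases h.eventually hβ hgs hy.1 hy.2 with ⟨n, hn⟩ | ⟨n, hn⟩
  · exact ⟨n, Or.inl hn⟩
  · exact ⟨n, Or.inr hn⟩

theorem exists_false_true {c : ℕ → Bool} {n : ℕ} (h0 : c 0 = false) (h1 : c n = true) :
    ∃ i, c i = false ∧ c (i + 1) = true := by
  induction n with
  | zero => rw [h0] at h1; cases h1
  | succ n ih =>
    cases h : c n
    · exact ⟨n, h, h1⟩
    · exact ih h

/-- The avoiders of the hole of a Farey descendant of a maximal extremal pair are countable. -/
theorem IsFareyDescendantOfMaximal.countable_avoiders (hβ : β ∈ Ioo (1 : ℝ) 2)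
    {s t : List Bool} (h : IsFareyDescendantOfMaximal β s t) (hadm : blocks s t ⊆ Admissible β) :
    (avoiders β (per s) (per t)).Countable := by
  obtain ⟨S, R, s₀, t₀, hmax, hdesc, rfl, rfl⟩ := h
  have hl := hmax.1.length_eq
  have hS := hmax.1.ne_nil
  have hSR := hmax.1.wordLT
  refine hdesc.countable_avoiders hl hSR (hmax.countable_avoiders hβ ?_)
  -- some concatenation of the words of the descendant contains the factor `S R`
  obtain ⟨hl0, ⟨s', hs'⟩, ⟨t', ht'⟩⟩ := hdesc.heads
  have hls : (subst S R s₀).length = (subst S R t₀).length := by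
    rw [length_subst hl, length_subst hl, hl0]
  have hs0 : subst S R s₀ ≠ [] := subst_ne_nil hS hSR.ne_nil_right (by simp [hs'])
  obtain ⟨-, -, hst, -, -, -⟩ := blk_mem hls hs0 hadm
  rw [← blk_per hl hS (by simp [ht']), ← blk_cat hl hS] at hst
  obtain ⟨i, hi0, hi1⟩ := exists_false_true (c := cat s₀ (per t₀)) (n := s₀.length)
    (by rw [hs']; simp) (by
      have := cat_apply_add s₀ 0 (per t₀)
      rw [zero_add] at this
      rw [this, ht', per_eq_cat, cat_cons_zero])
  have h1 := Admissible.shift hst (i * S.length)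
  rw [shift_blk hl hS, blk_eq_cat hl hS, shift_shift] at h1
  have e0 : shift i (cat s₀ (per t₀)) 0 = false := by rw [shift_apply, zero_add, hi0]
  rw [e0] at h1
  refine isGreedy_per_of_lexLT hβ hS h1 ?_
  rw [per_eq_cat]
  refine lexLT_cat.2 ?_
  rw [blk_eq_cat hl hS, shift_apply]
  rw [show 0 + (1 + i) = i + 1 by ring, hi1, per_eq_cat]
  exact hSR.cat _ _

/-- Avoidance sets of real intervals and of lexicographic intervals differ by countable sets. -/
theorem countable_J (hβ : β ∈ Ioo (1 : ℝ) 2) {p q : ℕ → Bool} (hp : p ∈ Admissible β)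
    (h : (avoiders β p q).Countable) : (J β (value β p) (value β q)).Countable := by
  have htails := countable_tails
    ((countable_singleton (greedy β (value β q))).insert (greedy β (value β p)))
  refine ((htails.union h).image (value β)).mono fun x hx => ?_
  have hx' : x ∈ Ico (0 : ℝ) 1 := ⟨hx.1.1.le, hx.1.2⟩
  have hg := isGreedy_greedy hβ hx'
  have hvx := value_greedy hβ (z := x) ⟨hx'.1, hx'.2.le⟩
  refine ⟨greedy β x, ?_, hvx⟩
  by_cases hend : ∃ n, (T β)^[n] x = value β p ∨ (T β)^[n] x = value β q
  · left
    obtain ⟨n, hn⟩ := hend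
    refine ⟨n, ?_⟩
    rw [shift_greedy]
    rcases hn with hn | hn <;> rw [hn]
    · exact Or.inl rfl
    · exact Or.inr rfl
  · right
    push Not at hend
    refine ⟨hg, fun n hn => hx.2 n ?_⟩
    have hT : (T β)^[n] x = value β (shift n (greedy β x)) := by rw [← hg.iterate_T hβ.1, hvx]
    have h1 := hn.1.value_le hβ.1 (Admissible.value_le_one hβ hp)
    have h2 := hn.2.value_le hβ.1 (hg.shift n).le
    rw [← hT] at h1 h2
    exact ⟨lt_of_le_of_ne h1 (hend n).1.symm, lt_of_le_of_ne h2 (hend n).2⟩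

theorem countable_dominated_base' :
    {c | Dominated {(fun _ => true), cat [false] fun _ => true} c}.Countable := by
  have := countable_dominated_negate countable_dominated_base
  rw [image_pair, negate_cat] at this
  exact this

end BetaHole

open BetaHole in
theorem mainTheorem2 (β : ℝ) (hβ : β ∈ Set.Ioo (1 : ℝ) 2) (s t u v : List Bool)
    (hext : IsExtremal s t) (hadm : blocks s t ⊆ Admissible β)
    (hI : (value β (per s), value β (per t)) ∈ regionI β)
    (hs : s = u ++ v) (ht : t = v ++ u) :
    {x | ∃ n : ℕ, x = value β (shift n (per s))} ⊆ J β (value β (per s)) (value β (per t)) ∧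
    (IsPrimitive s → ∀ ε : ℝ, 0 < ε →
      (¬ (J β (value β (per s)) (value β (cat t (per s)) - ε)).Countable ∧
        ¬ (J β (value β (cat s (per t)) + ε) (value β (per t))).Countable) ∧
      (Nat.Coprime u.length s.length →
        {n | IsBad β (value β (per s)) (value β (cat t (per s)) - ε) n}.Finite ∧
        {n | IsBad β (value β (cat s (per t)) + ε) (value β (per t)) n}.Finite ∧
        {n | IsBad β (value β (cat s (per t)) + ε) (value β (cat t (per s)) - ε) n}.Finite)) ∧
    (IsMaximal β s t →
      EssEq β (J β (value β (per s)) (value β (per t)))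
        ({x | ∃ n : ℕ, x = value β (shift n (per s))} ∪ {0}) ∧
      (1 / β ∈ Set.Ioo (value β (per s)) (value β (per t)) →
        EssEq β (J β (value β (per s)) (value β (per t)))
          {x | ∃ n : ℕ, x = value β (shift n (per s))})) ∧
    (IsFareyDescendantOfMaximal β s t →
      (J β (value β (per s)) (value β (per t))).Countable ∧
      (J β (value β (cat s (cat t (per s)))) (value β (cat t (per s)))).Countable ∧
      (J β (value β (cat s (per t))) (value β (cat t (cat s (per t))))).Countable) := by
  have hb := hβ.1
  have hgs := hext.isGreedy_left hβ hadm
  obtain ⟨hsadm, -, hstadm, htsadm, hstsadm, -⟩ := blk_mem hext.length_eq hext.ne_nil hadm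
  have hstail : ∀ {x : ℝ} {n : ℕ}, shift n (greedy β x) = per s →
      ∃ x' ∈ {x | ∃ n : ℕ, x = value β (shift n (per s))},
        ∃ w : List Bool, greedy β x = cat w (greedy β x') := by
    intro x n hn
    refine ⟨_, ⟨0, rfl⟩, pre n (greedy β x), ?_⟩
    rw [shift_zero, hgs.greedy_value hb, ← hn, cat_pre_shift]
  refine ⟨hext.orbit_subset_J hβ hgs, fun hp ε hε => ?_, fun hmax => ⟨?_, ?_⟩, fun hdesc => ?_⟩
  · subst hs ht
    have hu : u ≠ [] := by
      rintro rfl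
      have := hext.2.1
      simp only [List.nil_append, List.append_nil] at this
      exact LexLT.irrefl _ this
    have hv : v ≠ [] := by
      rintro rfl
      have := hext.2.1
      simp only [List.nil_append, List.append_nil] at this
      exact LexLT.irrefl _ this
    have hcomm : u ++ (v ++ u) ≠ v ++ u ++ u := by
      intro he
      rw [← List.append_assoc] at he
      have := hext.2.1
      rw [List.append_cancel_right he] at this
      exact LexLT.irrefl _ this
    have hleft := hext.chainsAvoid_left hβ hp hadm hu hε
    obtain ⟨a, k, hak, hcop, hright⟩ :=
      hext.exists_chainsAvoid_right hβ hp hadm hv hI.1.2 hε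
    refine ⟨⟨hleft.not_countable hβ hcomm, hright.not_countable hβ hak⟩, fun hc => ?_⟩
    have hfin := hleft.finite_bad hβ hcomm (by rwa [← hext.length_eq])
    refine ⟨hfin, hright.finite_bad hβ hak (hcop ?_), hfin.subset ?_⟩
    · rw [List.length_append] at hc ⊢
      rw [Nat.coprime_add_self_right]
      rw [Nat.coprime_self_add_right] at hc
      exact hc.symm
    · have hle : value β (per (u ++ v)) ≤ value β (cat (u ++ v) (per (v ++ u))) := by
        refine LexLT.value_le hb ?_ hgs.le
        conv_lhs => rw [per_eq_cat]
        exact lexLT_cat.2 hext.2.1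
      rintro n ⟨hn, hbad⟩
      refine ⟨hn, fun x hx hmin => ?_⟩
      obtain ⟨i, hi⟩ := hbad x hx hmin
      exact ⟨i, by linarith [hi.1], hi.2⟩
  · intro x hx
    rcases hmax.essEq hβ hgs hx with ⟨n, hn⟩ | ⟨n, hn⟩
    · refine ⟨0, Or.inr rfl, pre n (greedy β x), ?_⟩
      rw [greedy_zero, ← hn, cat_pre_shift]
    · obtain ⟨x', hx', h⟩ := hstail hn
      exact ⟨x', Or.inl hx', h⟩
  · intro hhole x hx
    rcases hmax.essEq hβ hgs hx with ⟨n, hn⟩ | ⟨n, hn⟩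
    · exact absurd hn (shift_greedy_ne_zero hβ hx hhole n)
    · exact hstail hn
  · have hc := hdesc.countable_avoiders hβ hadm
    have hl := hext.length_eq
    have hst := hext.wordLT
    have h0 : blk s t (fun _ => false) = per s := blk_const hl hext.ne_nil false
    have h1 : blk s t (fun _ => true) = per t := blk_const hl hext.ne_nil true
    have hs' : ∀ c, blk s t (cat [false] c) = cat s (blk s t c) := blk_cat_cons hl hext.ne_nil false
    have ht' : ∀ c, blk s t (cat [true] c) = cat t (blk s t c) := blk_cat_cons hl hext.ne_nil true
    refine ⟨countable_J hβ hsadm hc, countable_J hβ hstsadm ?_, countable_J hβ hstadm ?_⟩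
    · have := countable_avoiders_of_trap hl hst countable_dominated_base
        (c := cat [true] fun _ => false) (d := fun _ => false) (Or.inr rfl) (Or.inl rfl) hc
      rwa [hs', ht', h0] at this
    · have := countable_avoiders_of_trap hl hst countable_dominated_base'
        (c := fun _ => true) (d := cat [false] fun _ => true) (Or.inl rfl) (Or.inr rfl) hc
      rwa [hs', ht', hs', h1] at this
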